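/- Let $\mathbb K$ be an algebraically closed field of characteristic zero, let $r\ge 1$, and let $f_1,\dots,f_r\in\mathbb K[[X,Y]]$ be irreducible with $\langle f_i\rangle\ne\langle f_j\rangle$ for $i\neq j$. Put $f=f_1\cdots f_r$ and $\mathcal O=\mathbb K[[X,Y]]/\langle f\rangle$, with maximal ideal $\mathcal M$. For each $i$ let $\varphi_i(t_i)=(x(t_i),y(t_i))$ be a parameterization of the branch $\langle f_i\rangle$: the map $\mathbb K[[X,Y]]\to\mathbb K[[t_i]]$, $h\mapsto h(\varphi_i(t_i))$, has kernel $\langle f_i\rangle$, and $\mathbb K[[t_i]]$ is the integral closure of its image $\mathcal O_i$ in its field of fractions $\mathbb K((t_i))$. Embed $\mathcal O$ in $\overline{\mathcal O}=\bigoplus_{i=1}^r\mathbb K[[t_i]]$ by $g\mapsto (g(\varphi_i(t_i)))_i$. For $w=(w_1,\dots,w_r)\in\overline{\mathcal O}$ write $v_i(w)=\operatorname{ord}_{t_i}w_i\in\mathbb N\cup\{\infty\}$. Let $\Omega=(\mathcal O\,dx+\mathcal O\,dy)/(f_x\,dx+f_y\,dy)\mathcal O$, let $d:\mathcal O\to\Omega$,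 $dh=h_x\,dx+h_y\,dy$, and let $\varphi^*:\Omega\to\overline{\mathcal O}$ be the $\mathcal O$-linear map $p\,dx+q\,dy\mapsto \bigl(t_i\,(p(\varphi_i(t_i))x'(t_i)+q(\varphi_i(t_i))y'(t_i))\bigr)_i$. Differentials are identified with their images under $\varphi^*$. For $G\subset\mathcal O$, a $G$-product is a finite product of elements of $G$ (repetitions and the empty product allowed). For $G\subset\mathcal O$, $H\subset\overline{\mathcal O}$ and $w\in\overline{\mathcal O}$, a reduction of $w$ modulo $(H,G)$ is an element $w'=w-c\,g\,h$ with $c\in\mathbb K$, $g$ a $G$-product and $h\in H$, such that $v_i(w')\ge v_i(w)$ for all $i$ and $v_k(w')>v_k(w)$ for some $k$ with $v_k(w)\neq\infty$. A final reduction of $w$ is an element that has no reduction and is obtained from $w$ by a finite or infinite sequence of reductions, as its last term or its limit. An $S_k$-process of $H$ over $G$ is an element $c_1g_1h_1+c_2g_2h_2$ with $c_1,c_2\in\mathbb K$, $G$-products $g_1,g_2$ and $h_1,h_2\in H$, such that $v_k(c_1g_1h_1+c_2g_2h_2)>\min\{v_k(g_1h_1),v_k(g_2h_2)\}$. For an $\mathcal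 O$-submodule $\mathcal I\subset\overline{\mathcal O}$, a pair of finite sets $G\subset\mathcal M\setminus\{0\}$, $H\subset\mathcal I\setminus\{0\}$ is a Standard Basis for $\mathcal I$ if every nonzero element of $\mathcal I$ has a reduction modulo $(H,G)$. A Standard Basis for $\mathcal O$ is a set $G$ such that $(G,\{1\})$ is a Standard Basis for $\mathcal I=\mathcal O$, and $H$ is a Standard Basis for $\Omega$ (with $G$ fixed) if $(G,H)$ is one for $\mathcal I=\varphi^*(\Omega)$. Let $\sigma=(\sigma_1,\dots,\sigma_r)\in\mathbb N^r$ be the conductor of the curve, defined by $(\mathcal O:\overline{\mathcal O})=(t_1^{\sigma_1},\dots,t_r^{\sigma_r})\overline{\mathcal O}$. It exists, and $\sigma_i=\mu_i+\sum_{j\ne i}v_i(f_j)$, where $\mu_i$ is the conductor of $v_i(\mathcal O_i)$, that is, the least $c$ such that all integers $n\ge c$ lie in $v_i(\mathcal O_i)$. Let $G$ be a Standard Basis for $\mathcal O$ that contains the class of every $f_i$ (for $r=1$, where the class of $f_1$ is $0$, this condition is void). Consider the following algorithm. Start with $H_0=\{dg:\ g\in G\}$. Given $H_j$, let $\mathcal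 S$ be the set of all $\omega$ that are an $S_k$-process of $H_j$ over $G$ for some $k$ and satisfy $v_i(\omega)<\sigma_i$ for some $i$, two such elements being identified if they differ by a nonzero constant factor; choose for each element of $\mathcal S$ a final reduction modulo $(H_j,G)$, let $\mathcal R$ be the set of the nonzero ones among them, and put $H_{j+1}=H_j\cup\mathcal R$. Stop as soon as $H_{j+1}=H_j$, with output $H=H_j$. Then the algorithm always produces a Standard Basis for $\Omega$. That is: in every execution each $H_j$ is finite, $\mathcal S$ is finite up to nonzero constant factors and each of its elements has a final reduction, so that every step can be carried out; every execution stops after finitely many steps, whatever choices are made; and its output $H$ is a Standard Basis for $\Omega$. -/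

import Mathlib

open scoped PowerSeries LaurentSeries

noncomputable section

/-- A reduced algebroid plane curve `⟨f₁ ⋯ f_r⟩ ⊆ K⟦X, Y⟧` (the variables `X, Y` are `MvPowerSeries.X 0`
and `MvPowerSeries.X 1`), with a chosen parameterization of each of its branches.

The parameterization `φᵢ(t) = (x(t), y(t))` of the branch `⟨fᵢ⟩` is given by the homomorphism of
`K`-algebras `h ↦ h(x(t), y(t))` from `K⟦X, Y⟧` to `K⟦t⟧`, where `x(t), y(t)` are the images of
`X, Y`. (Every homomorphism of `K`-algebras `K⟦X, Y⟧ → K⟦t⟧` is local, hence continuous, hence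
of this form.) Its kernel is `⟨fᵢ⟩`, so its range is the local ring `Oᵢ` of the branch, and `K⟦t⟧` is
the integral closure of `Oᵢ` in its field of fractions `K⸨t⸩`. -/
structure ParamPlaneCurve (K : Type*) [Field K] (r : ℕ) where
  /-- the equations of the branches -/
  f : Fin r → MvPowerSeries (Fin 2) K
  irreducible_f : ∀ i, Irreducible (f i)
  span_ne : ∀ i j, i ≠ j → Ideal.span {f i} ≠ Ideal.span {f j}
  /-- the parameterizations of the branches -/
  param : Fin r → (MvPowerSeries (Fin 2) K →ₐ[K] K⟦X⟧)
  ker_param : ∀ i, RingHom.ker (param i) = Ideal.span {f i}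
  isFractionRing : ∀ i, IsFractionRing (param i).range K⸨X⸩
  isIntegralClosure : ∀ i, IsIntegralClosure K⟦X⟧ (param i).range K⸨X⸩

namespace ParamPlaneCurve

section Derivative

variable {K : Type*} [Field K]

/-- Every power series in two variables is of the form `c + X h₁ + Y h₂`. -/
theorem exists_decomp (h : MvPowerSeries (Fin 2) K) :
    ∃ (c : K) (h₁ h₂ : MvPowerSeries (Fin 2) K),
      h = MvPowerSeries.C c + MvPowerSeries.X 0 * h₁ + MvPowerSeries.X 1 * h₂ := by
  classical
  let h₁ : MvPowerSeries (Fin 2) K :=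
    fun n => MvPowerSeries.coeff (Finsupp.single 0 1 + n) h
  let c : K := MvPowerSeries.constantCoeff h
  have key : (MvPowerSeries.X (1 : Fin 2) : MvPowerSeries (Fin 2) K) ∣
      h - MvPowerSeries.C c - MvPowerSeries.X 0 * h₁ := by
    rw [MvPowerSeries.X_dvd_iff]
    intro m hm
    by_cases h0 : m 0 = 0
    · have hm0 : m = 0 := by
        ext j
        fin_cases j
        · exact h0
        · exact hm
      subst hm0
      simp [c]
    · have hle : Finsupp.single (0 : Fin 2) 1 ≤ m := by
        rw [Finsupp.single_le_iff]
        omega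
      obtain ⟨n, rfl⟩ := exists_add_of_le hle
      have hne : Finsupp.single (0 : Fin 2) 1 + n ≠ 0 := by
        intro h'
        rw [h'] at h0
        exact h0 rfl
      rw [map_sub, map_sub, MvPowerSeries.coeff_C, if_neg hne, MvPowerSeries.X_def,
        MvPowerSeries.coeff_add_monomial_mul, one_mul]
      simp only [sub_zero]
      exact sub_self _
  obtain ⟨h₂, hh⟩ := key
  exact ⟨c, h₁, h₂, by rw [← hh]; ring⟩

/-- A homomorphism of `K`-algebras `K⟦X, Y⟧ → K⟦t⟧` is local. -/
theorem constantCoeff_map_X (φ : MvPowerSeries (Fin 2) K →ₐ[K] K⟦X⟧) (s : Fin 2) :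
    PowerSeries.constantCoeff (φ (MvPowerSeries.X s)) = 0 := by
  by_contra hc
  set c := PowerSeries.constantCoeff (φ (MvPowerSeries.X s)) with hcdef
  have hu : IsUnit (MvPowerSeries.X s - algebraMap K (MvPowerSeries (Fin 2) K) c) := by
    rw [MvPowerSeries.isUnit_iff_constantCoeff, map_sub, MvPowerSeries.constantCoeff_X,
      ← MvPowerSeries.c_eq_algebraMap, MvPowerSeries.constantCoeff_C, zero_sub]
    exact (IsUnit.mk0 c hc).neg
  have hv := hu.map φ
  rw [map_sub, AlgHom.commutes, PowerSeries.isUnit_iff_constantCoeff, map_sub, ← hcdef,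
    PowerSeries.algebraMap_apply, Algebra.algebraMap_self, RingHom.id_apply,
    PowerSeries.constantCoeff_C, sub_self] at hv
  exact not_isUnit_zero hv

/-- The chain rule `d/dt h(x(t), y(t)) = h_x(x(t), y(t)) x'(t) + h_y(x(t), y(t)) y'(t)`. -/
theorem derivative_param (φ : MvPowerSeries (Fin 2) K →ₐ[K] K⟦X⟧) (h : MvPowerSeries (Fin 2) K) :
    PowerSeries.derivative K (φ h) =
      φ (MvPowerSeries.pderiv K 0 h) * PowerSeries.derivative K (φ (MvPowerSeries.X 0)) +
      φ (MvPowerSeries.pderiv K 1 h) * PowerSeries.derivative K (φ (MvPowerSeries.X 1)) := by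
  classical
  let E : MvPowerSeries (Fin 2) K → K⟦X⟧ := fun h =>
    PowerSeries.derivative K (φ h) -
      (φ (MvPowerSeries.pderiv K 0 h) * PowerSeries.derivative K (φ (MvPowerSeries.X 0)) +
      φ (MvPowerSeries.pderiv K 1 h) * PowerSeries.derivative K (φ (MvPowerSeries.X 1)))
  have hadd : ∀ a b, E (a + b) = E a + E b := by
    intro a b
    simp only [E, map_add]
    ring
  have hmul : ∀ a b, E (a * b) = φ a * E b + φ b * E a := by
    intro a b
    simp only [E, map_mul, Derivation.leibniz, map_add, smul_eq_mul]
    ring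
  have hC : ∀ c, E (MvPowerSeries.C c) = 0 := by
    intro c
    simp only [E, MvPowerSeries.c_eq_algebraMap, AlgHom.commutes, Derivation.map_algebraMap,
      map_zero, zero_mul, add_zero, sub_zero]
  have hX0 : E (MvPowerSeries.X 0) = 0 := by
    simp [E]
  have hX1 : E (MvPowerSeries.X 1) = 0 := by
    simp [E]
  have hdvd : ∀ n : ℕ, ∀ h, (PowerSeries.X : K⟦X⟧) ^ n ∣ E h := by
    intro n
    induction n with
    | zero => intro h; simp
    | succ n ih =>
      intro h
      obtain ⟨c, h₁, h₂, rfl⟩ := exists_decomp h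
      rw [hadd, hadd, hC, hmul, hmul, hX0, hX1, zero_add, mul_zero, mul_zero, add_zero, add_zero,
        pow_succ']
      exact dvd_add
        (mul_dvd_mul (PowerSeries.X_dvd_iff.mpr (constantCoeff_map_X φ 0)) (ih h₁))
        (mul_dvd_mul (PowerSeries.X_dvd_iff.mpr (constantCoeff_map_X φ 1)) (ih h₂))
  have hE : E h = 0 := by
    ext n
    rw [map_zero]
    exact PowerSeries.X_pow_dvd_iff.mp (hdvd (n + 1) h) n (Nat.lt_succ_self n)
  exact sub_eq_zero.mp hE

end Derivative

variable {K : Type*} [Field K] {r : ℕ} (C : ParamPlaneCurve K r)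

/-- The equation `f = f₁ ⋯ f_r` of the curve. -/
def eqn : MvPowerSeries (Fin 2) K := ∏ i, C.f i

/-- The local ring `O = K⟦X, Y⟧ / ⟨f⟩` of the curve. -/
abbrev LocalRing : Type _ := MvPowerSeries (Fin 2) K ⧸ Ideal.span {C.eqn}

/-- The class in `O` of a power series. -/
def cls : MvPowerSeries (Fin 2) K →+* C.LocalRing := Ideal.Quotient.mk _

theorem param_eqn (i : Fin r) : C.param i C.eqn = 0 := by
  have h : C.f i ∈ RingHom.ker (C.param i) := by
    rw [C.ker_param i]
    exact Ideal.mem_span_singleton_self _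
  have h' : C.param i (C.f i) = 0 := h
  rw [eqn, map_prod]
  exact Finset.prod_eq_zero (Finset.mem_univ i) h'

/-- The embedding `O → K⟦t₁⟧ ⊕ ⋯ ⊕ K⟦t_r⟧`, `g ↦ (g(φ₁(t₁)), …, g(φ_r(t_r)))`, of `O` in its
integral closure. -/
def psi : C.LocalRing →+* (Fin r → K⟦X⟧) :=
  Ideal.Quotient.lift _ (RingHom.pi fun i => (C.param i : MvPowerSeries (Fin 2) K →+* K⟦X⟧)) (by
    intro a ha
    obtain ⟨b, rfl⟩ := Ideal.mem_span_singleton'.mp ha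
    funext i
    change C.param i (b * C.eqn) = 0
    rw [map_mul, C.param_eqn i, mul_zero])

/-! ### Conductors -/

/-- The set `Γᵢ = vᵢ(Oᵢ)` of values of the `i`-th branch. -/
def branchValues (i : Fin r) : Set ℕ∞ := Set.range fun h => (C.param i h).order

/-- The conductor `μᵢ` of `Γᵢ`: the least `c` with `c + ℕ ⊆ Γᵢ`. -/
def branchConductor (i : Fin r) : ℕ :=
  sInf {c : ℕ | ∀ n : ℕ, c ≤ n → (n : ℕ∞) ∈ C.branchValues i}

/-- `σ` is the conductor of the curve: the conductor ideal `(O : K⟦t₁⟧ ⊕ ⋯ ⊕ K⟦t_r⟧)` is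
`(t₁^σ₁, …, t_r^σ_r) (K⟦t₁⟧ ⊕ ⋯ ⊕ K⟦t_r⟧)`. -/
def IsConductor (σ : Fin r → ℕ) : Prop :=
  {c : Fin r → K⟦X⟧ | ∀ b, c * b ∈ Set.range C.psi} =
    {c : Fin r → K⟦X⟧ | ∀ i, (σ i : ℕ∞) ≤ (c i).order}

/-! ### Kähler differentials -/

/-- The module of Kähler differentials `Ω = (O dx + O dy) / (f_x dx + f_y dy) O`; the pair `(p, q)`
stands for `p dx + q dy`. -/
abbrev Omega : Type _ :=
  (C.LocalRing × C.LocalRing) ⧸ Submodule.span C.LocalRing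
    {(C.cls (MvPowerSeries.pderiv K 0 C.eqn), C.cls (MvPowerSeries.pderiv K 1 C.eqn))}

/-- The differential `d : O → Ω`, `dh = h_x dx + h_y dy`. -/
def d (g : C.LocalRing) : C.Omega :=
  Quotient.liftOn' g
    (fun h => Submodule.Quotient.mk
      (C.cls (MvPowerSeries.pderiv K 0 h), C.cls (MvPowerSeries.pderiv K 1 h)))
    (by
      intro a b hab
      have hab' : a - b ∈ Ideal.span {C.eqn} := (Submodule.quotientRel_def _).mp hab
      obtain ⟨u, hu⟩ := Ideal.mem_span_singleton'.mp hab'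
      rw [Submodule.Quotient.eq, Submodule.mem_span_singleton]
      have h0 : C.cls C.eqn = 0 :=
        Ideal.Quotient.eq_zero_iff_mem.mpr (Ideal.mem_span_singleton_self _)
      refine ⟨C.cls u, ?_⟩
      rw [Prod.mk_sub_mk, ← map_sub, ← map_sub, ← map_sub, ← map_sub, ← hu, Derivation.leibniz,
        Derivation.leibniz]
      simp [h0])

theorem d_cls (h : MvPowerSeries (Fin 2) K) :
    C.d (C.cls h) = Submodule.Quotient.mk
      (C.cls (MvPowerSeries.pderiv K 0 h), C.cls (MvPowerSeries.pderiv K 1 h)) := rfl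

/-- The map `p dx + q dy ↦ (tᵢ (p(φᵢ(tᵢ)) x'(tᵢ) + q(φᵢ(tᵢ)) y'(tᵢ)))ᵢ` on `O dx + O dy`. -/
def freePullback : (C.LocalRing × C.LocalRing) →ₛₗ[C.psi] (Fin r → K⟦X⟧) where
  toFun ω i := PowerSeries.X *
    (C.psi ω.1 i * PowerSeries.derivative K (C.param i (MvPowerSeries.X 0)) +
      C.psi ω.2 i * PowerSeries.derivative K (C.param i (MvPowerSeries.X 1)))
  map_add' a b := by
    funext i
    simp only [Prod.fst_add, Prod.snd_add, map_add, Pi.add_apply]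
    ring
  map_smul' c a := by
    funext i
    simp only [Prod.smul_fst, Prod.smul_snd, smul_eq_mul, map_mul, Pi.mul_apply]
    ring

/-- The homomorphism `φ* : Ω → K⟦t₁⟧ ⊕ ⋯ ⊕ K⟦t_r⟧` of `O`-modules. -/
def pullback : C.Omega →ₛₗ[C.psi] (Fin r → K⟦X⟧) :=
  Submodule.liftQ _ C.freePullback (by
    rw [Submodule.span_le, Set.singleton_subset_iff]
    change C.freePullback _ = 0
    funext i
    have h := derivative_param (C.param i) C.eqn
    rw [C.param_eqn i, map_zero] at h
    change PowerSeries.X *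
      (C.param i (MvPowerSeries.pderiv K 0 C.eqn) * PowerSeries.derivative K (C.param i (MvPowerSeries.X 0)) +
        C.param i (MvPowerSeries.pderiv K 1 C.eqn) *
          PowerSeries.derivative K (C.param i (MvPowerSeries.X 1))) = 0
    rw [← h, mul_zero])

/-! ### Reductions and Standard Bases

In what follows `G` is a set of elements of `O` and `H` a set of elements of `K⟦t₁⟧ ⊕ ⋯ ⊕ K⟦t_r⟧`.
The `G`-products are the elements of `Submonoid.closure G`, and the `i`-th value of an element `w` is
`(w i).order`, which is `⊤` exactly if `w i = 0`. -/

/-- `w'` is a `k`-reduction of `w` modulo `(H, G)`. -/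
def IsKReduction (G : Set C.LocalRing) (H : Set (Fin r → K⟦X⟧)) (k : Fin r)
    (w w' : Fin r → K⟦X⟧) : Prop :=
  (w k).order ≠ ⊤ ∧
  (∃ c : K, ∃ m ∈ Submonoid.closure G, ∃ h ∈ H, w' = w - c • (C.psi m * h)) ∧
  (∀ i, (w i).order ≤ (w' i).order) ∧ (w k).order < (w' k).order

/-- `w'` is a reduction of `w` modulo `(H, G)`. -/
def IsReduction (G : Set C.LocalRing) (H : Set (Fin r → K⟦X⟧)) (w w' : Fin r → K⟦X⟧) : Prop :=
  ∃ k, C.IsKReduction G H k w w'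

/-- `(G, H)` is a Standard Basis for the fractional ideal `I`. -/
def IsStandardBasis (I : Set (Fin r → K⟦X⟧)) (G : Set C.LocalRing) (H : Set (Fin r → K⟦X⟧)) :
    Prop :=
  G.Finite ∧ G ⊆ nonunits C.LocalRing \ {0} ∧ H.Finite ∧ H ⊆ I \ {0} ∧
    ∀ w ∈ I, w ≠ 0 → ∃ w', C.IsReduction G H w w'

/-- `G` is a Standard Basis for the local ring `O`. -/
def IsStandardBasisLocalRing (G : Set C.LocalRing) : Prop :=
  C.IsStandardBasis (Set.range C.psi) G {1}

/-- `(G, H)` is a Standard Basis for `Ω`, that is, for the fractional ideal `φ*(Ω)`. -/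
def IsStandardBasisOmega (G : Set C.LocalRing) (H : Set (Fin r → K⟦X⟧)) : Prop :=
  C.IsStandardBasis (Set.range C.pullback) G H

/-- `w'` is a final reduction of `w` modulo `(H, G)`: it is obtained from `w` by a finite or infinite
sequence of reductions, as its last term or as its limit (in the product of the `t`-adic topologies),
and has no reduction itself. A finite sequence is written as an eventually constant one. -/
def IsFinalReduction (G : Set C.LocalRing) (H : Set (Fin r → K⟦X⟧)) (w w' : Fin r → K⟦X⟧) : Prop :=
  (∃ s : ℕ → Fin r → K⟦X⟧, s 0 = w ∧
    (∀ n, C.IsReduction G H (s n) (s (n + 1)) ∨ s (n + 1) = s n) ∧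
    (∀ N : ℕ, ∃ m, ∀ n, m ≤ n → ∀ i, (N : ℕ∞) ≤ (s n i - w' i).order)) ∧
  ¬ ∃ w'', C.IsReduction G H w' w''

/-- `w` is an `S_k`-process of `H` over `G`. -/
def IsSCombination (G : Set C.LocalRing) (H : Set (Fin r → K⟦X⟧)) (k : Fin r) (w : Fin r → K⟦X⟧) :
    Prop :=
  ∃ c₁ c₂ : K, ∃ m₁ ∈ Submonoid.closure G, ∃ m₂ ∈ Submonoid.closure G, ∃ h₁ ∈ H, ∃ h₂ ∈ H,
    w = c₁ • (C.psi m₁ * h₁) + c₂ • (C.psi m₂ * h₂) ∧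
    min ((C.psi m₁ * h₁) k).order ((C.psi m₂ * h₂) k).order < (w k).order

/-! ### The algorithm -/

/-- The set `𝒮` of the `S_k`-processes `w` of `H` over `G`, for all `k`, with `vᵢ(w) < σᵢ` for
some `i`. -/
def processes (G : Set C.LocalRing) (σ : Fin r → ℕ) (H : Set (Fin r → K⟦X⟧)) :
    Set (Fin r → K⟦X⟧) :=
  {w | (∃ k, C.IsSCombination G H k w) ∧ ∃ i, (w i).order < (σ i : ℕ∞)}

/-- `T` is a set of representatives of `S` up to nonzero constant factors. -/
def IsRepresentatives (S T : Set (Fin r → K⟦X⟧)) : Prop :=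
  T ⊆ S ∧ ∀ w ∈ S, ∃! w₀, w₀ ∈ T ∧ ∃ c : K, c ≠ 0 ∧ w = c • w₀

/-- The input `H₀ = {dg ; g ∈ G}` of the loop, viewed in `φ*(Ω)`. -/
def initial (G : Set C.LocalRing) : Set (Fin r → K⟦X⟧) := (fun g => C.pullback (C.d g)) '' G

/-- One passage through the loop may lead from `H` to `H'`: for each member of `𝒮`, up to constant
factors, a final reduction modulo `(H, G)` is chosen, and the nonzero ones are added to `H`. -/
def Step (G : Set C.LocalRing) (σ : Fin r → ℕ) (H H' : Set (Fin r → K⟦X⟧)) : Prop :=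
  ∃ (T : Set (Fin r → K⟦X⟧)) (ρ : (Fin r → K⟦X⟧) → (Fin r → K⟦X⟧)),
    IsRepresentatives (C.processes G σ H) T ∧
    (∀ w ∈ T, C.IsFinalReduction G H w (ρ w)) ∧
    H' = H ∪ (ρ '' T \ {0})

/-- `H` occurs as some `H_j` in some execution of the loop. -/
def Reachable (G : Set C.LocalRing) (σ : Fin r → ℕ) (H : Set (Fin r → K⟦X⟧)) : Prop :=
  Relation.ReflTransGen (C.Step G σ) (C.initial G) H

end ParamPlaneCurve

end

noncomputable section

/-! ### Orders of power series and limits of tuples -/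

section Order

variable {K : Type*} [Field K]

/-! Everything is governed by the set P of products of a G-product with an element of the current H.
As G lies in the maximal ideal, a product of n elements of G has all values at least n, so only
finitely many elements of P have some value below a given bound (`finiteBelow_prods`). Hence
reducing always at the least reducible value stops or converges to a final reduction
(`exists_final_reduction`). Moreover the cancellation in a process fixes the ratio of its
coefficients, so up to scalars only finitely many processes have a value below the conductor
(`exists_finite_cover_processes`).

Termination: in characteristic zero `dg` has the same values as a g in the maximal ideal. Beyond the
conductor, O contains tuples supported on a single branch, so some product m·dg has any prescribed
large value at k and vanishes on the other branches. Thus a positive finite value not below the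
conductor always permits a reduction (`exists_kReduces_of_le_order`). The value vectors of new
elements therefore lie in a finite set, and none repeats, since an element with the values of a
member of H is reducible.

Correctness is a criterion of Buchberger type (`exists_kReduces_of_mem_spanAbove`). By the Leibniz
rule each differential is a K-combination of elements of P up to high order. When H is stable, every
process reduces to zero, so it is a combination of elements of P whose values are no smaller than
its own. Substituting such expressions raises the lower bounds for the values in a representation of
w until they match the values of w; then one of the terms reduces w. Infinite combinations are
avoided by working modulo tuples of order N, for every N. -/

theorem natCast_le_order_iff {n : ℕ} {φ : K⟦X⟧} :
    (n : ℕ∞) ≤ φ.order ↔ ∀ j < n, PowerSeries.coeff j φ = 0 :=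
  ⟨fun h j hj => PowerSeries.coeff_of_lt_order j (lt_of_lt_of_le (by exact_mod_cast hj) h),
    fun h => PowerSeries.nat_le_order φ n h⟩

theorem le_order_add_of_le {a : ℕ∞} {φ ψ : K⟦X⟧} (h₁ : a ≤ φ.order) (h₂ : a ≤ ψ.order) :
    a ≤ (φ + ψ).order :=
  (le_min h₁ h₂).trans (PowerSeries.min_order_le_order_add φ ψ)

theorem le_order_sub_of_le {a : ℕ∞} {φ ψ : K⟦X⟧} (h₁ : a ≤ φ.order) (h₂ : a ≤ ψ.order) :
    a ≤ (φ - ψ).order := by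
  rw [sub_eq_add_neg]
  exact le_order_add_of_le h₁ (by rwa [PowerSeries.order_neg])

theorem le_order_smul_of_le {a : ℕ∞} {φ : K⟦X⟧} (c : K) (h : a ≤ φ.order) : a ≤ (c • φ).order :=
  h.trans PowerSeries.le_order_smul

theorem order_smul_of_ne_zero {c : K} (hc : c ≠ 0) (φ : K⟦X⟧) : (c • φ).order = φ.order := by
  refine le_antisymm ?_ PowerSeries.le_order_smul
  have h : (c • φ).order ≤ (c⁻¹ • c • φ).order := PowerSeries.le_order_smul
  rwa [inv_smul_smul₀ hc] at h

theorem order_sub_eq_of_lt {φ ψ : K⟦X⟧} (h : φ.order < ψ.order) : (φ - ψ).order = φ.order := by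
  have h' : φ.order ≠ (-ψ).order := by rw [PowerSeries.order_neg]; exact h.ne
  rw [sub_eq_add_neg, PowerSeries.order_add_of_order_ne _ _ h', PowerSeries.order_neg]
  exact inf_eq_left.mpr h.le

theorem natCast_lt_order_of_coeff_eq_zero {n : ℕ} {φ : K⟦X⟧} (h : (n : ℕ∞) ≤ φ.order)
    (hc : PowerSeries.coeff n φ = 0) : (n : ℕ∞) < φ.order := by
  have : ((n + 1 : ℕ) : ℕ∞) ≤ φ.order := by
    rw [natCast_le_order_iff] at h ⊢
    intro j hj
    rcases Nat.lt_succ_iff_lt_or_eq.mp hj with h' | rfl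
    · exact h j h'
    · exact hc
  exact lt_of_lt_of_le (by exact_mod_cast Nat.lt_succ_self n) this

theorem exists_lt_order_sub_smul {φ ψ : K⟦X⟧} (h : φ.order = ψ.order) (ht : φ.order ≠ ⊤) :
    ∃ c : K, φ.order < (φ - c • ψ).order := by
  obtain ⟨n, hn⟩ := ENat.ne_top_iff_exists.mp ht
  have h2 := (PowerSeries.order_eq_nat.mp (h.symm.trans hn.symm)).1
  refine ⟨PowerSeries.coeff n φ / PowerSeries.coeff n ψ, ?_⟩
  rw [← hn]
  refine natCast_lt_order_of_coeff_eq_zero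
    (le_order_sub_of_le hn.le (le_order_smul_of_le _ (hn.le.trans h.le))) ?_
  rw [map_sub, PowerSeries.coeff_smul, smul_eq_mul, div_mul_cancel₀ _ h2, sub_self]

/-- A sequence of tuples of power series whose differences tend to zero converges. -/
theorem exists_limit {ι : Type*} [Finite ι] (s : ℕ → ι → K⟦X⟧)
    (hs : ∀ N : ℕ, ∃ m, ∀ n, m ≤ n → ∀ i, (N : ℕ∞) ≤ (s (n + 1) i - s n i).order) :
    ∃ w : ι → K⟦X⟧, ∀ N : ℕ, ∃ m, ∀ n, m ≤ n → ∀ i, (N : ℕ∞) ≤ (s n i - w i).order := by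
  choose M hM using hs
  have key : ∀ N n, M N ≤ n → ∀ i, (N : ℕ∞) ≤ (s n i - s (M N) i).order := by
    intro N n hn i
    induction n, hn using Nat.le_induction with
    | base => simp
    | succ n hn ih =>
      have := le_order_add_of_le (hM N n hn i) ih
      rwa [sub_add_sub_cancel] at this
  -- From the index `M (j + 1)` on, the coefficient of degree j no longer changes.
  refine ⟨fun i => PowerSeries.mk fun j => PowerSeries.coeff j (s (M (j + 1)) i), fun N => ?_⟩
  refine ⟨(Finset.range (N + 1)).sup M, fun n hn i => ?_⟩
  rw [natCast_le_order_iff]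
  intro j hj
  have h1 : M (j + 1) ≤ n :=
    (Finset.le_sup (f := M) (Finset.mem_range.mpr (Nat.succ_lt_succ hj))).trans hn
  have h2 := natCast_le_order_iff.mp (key (j + 1) n h1 i) j (Nat.lt_succ_self j)
  rw [map_sub] at h2 ⊢
  rwa [PowerSeries.coeff_mk]

end Order

/-! ### Reductions modulo an arbitrary set of tuples -/

section Reduction

variable {K : Type*} [Field K] {ι : Type*}

/-- `w'` arises from `w` by subtracting a multiple of an element of `P` which increases the `k`-th
value and decreases none. -/
def KReduces (P : Set (ι → K⟦X⟧)) (k : ι) (w w' : ι → K⟦X⟧) : Prop :=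
  (w k).order ≠ ⊤ ∧ (∃ c : K, ∃ p ∈ P, w' = w - c • p) ∧
    (∀ i, (w i).order ≤ (w' i).order) ∧ (w k).order < (w' k).order

theorem KReduces.exists_of_order {P : Set (ι → K⟦X⟧)} {k : ι} {w p : ι → K⟦X⟧} (hp : p ∈ P)
    (ht : (w k).order ≠ ⊤) (hle : ∀ i, (w i).order ≤ (p i).order)
    (heq : (p k).order = (w k).order) : ∃ w', KReduces P k w w' := by
  obtain ⟨c, hc⟩ := exists_lt_order_sub_smul heq.symm ht
  exact ⟨w - c • p, ht, ⟨c, p, hp, rfl⟩,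
    fun i => le_order_sub_of_le le_rfl (le_order_smul_of_le c (hle i)), hc⟩

/-- A strict increase of a value forces c ≠ 0, so p is proportional to w - w' and its values can be
read off. -/
theorem KReduces.exists_eq {P : Set (ι → K⟦X⟧)} {k : ι} {w w' : ι → K⟦X⟧}
    (h : KReduces P k w w') : ∃ c : K, ∃ p ∈ P, w' = w - c • p ∧
      (∀ i, (w i).order ≤ (p i).order) ∧ (p k).order = (w k).order := by
  obtain ⟨ht, ⟨c, p, hp, rfl⟩, hle, hlt⟩ := h
  have hc : c ≠ 0 := by
    rintro rfl
    simp at hlt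
  have hcp : ∀ i, (c • p) i = w i - (w - c • p) i := fun i => by simp
  refine ⟨c, p, hp, rfl, fun i => ?_, ?_⟩
  · rw [← order_smul_of_ne_zero hc (p i)]
    change _ ≤ ((c • p) i).order
    rw [hcp i]
    exact le_order_sub_of_le le_rfl (hle i)
  · rw [← order_smul_of_ne_zero hc (p k)]
    change ((c • p) k).order = _
    rw [hcp k]
    exact order_sub_eq_of_lt hlt

/-- There are only finitely many elements of `P` that have a value below a given bound. -/
def FiniteBelow (P : Set (ι → K⟦X⟧)) : Prop :=
  ∀ B : ℕ, {p ∈ P | ∃ i, (p i).order ≤ (B : ℕ∞)}.Finite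

/-- Used contrapositively: one finite value of p that is at least B' makes all values of p exceed B.
-/
theorem FiniteBelow.exists_bound [Finite ι] {P : Set (ι → K⟦X⟧)} (hP : FiniteBelow P) (B : ℕ) :
    ∃ B' : ℕ, ∀ p ∈ P, (∃ i, (p i).order ≤ (B : ℕ∞)) → ∀ k, (p k).order ≠ ⊤ →
      (p k).order < (B' : ℕ∞) := by
  have hfin : ((fun q : (ι → K⟦X⟧) × ι => (q.1 q.2).order.toNat) ''
      ({p ∈ P | ∃ i, (p i).order ≤ (B : ℕ∞)} ×ˢ Set.univ)).Finite :=
    ((hP B).prod Set.finite_univ).image _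
  obtain ⟨b, hb⟩ := hfin.bddAbove
  refine ⟨b + 1, fun p hp hi k hk => ?_⟩
  have := hb ⟨(p, k), ⟨⟨hp, hi⟩, Set.mem_univ _⟩, rfl⟩
  rw [← ENat.natCast_toNat hk]
  exact_mod_cast Nat.lt_succ_of_le this

theorem exists_eventually_stable {f : ℕ → ℕ∞} (hf : Monotone f) (N : ℕ) :
    ∃ m, (∀ n, m ≤ n → (N : ℕ∞) ≤ f n) ∨ ∀ n, m ≤ n → f n = f m := by
  induction N with
  | zero => exact ⟨0, Or.inl fun n _ => by simp⟩
  | succ N ih =>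
    obtain ⟨m, hm⟩ := ih
    by_cases h1 : ∃ n, ((N + 1 : ℕ) : ℕ∞) ≤ f n
    · obtain ⟨n, hn⟩ := h1
      exact ⟨n, Or.inl fun n' hn' => hn.trans (hf hn')⟩
    push Not at h1
    have h1' : ∀ n, f n ≤ N := fun n => by
      have := h1 n
      rw [Nat.cast_add, Nat.cast_one] at this
      exact Order.le_of_lt_add_one this
    rcases hm with hm | hm
    · exact ⟨m, Or.inr fun n hn => le_antisymm ((h1' n).trans (hm m le_rfl)) (hf hn)⟩
    · exact ⟨m, Or.inr hm⟩

/-- `w'` is the end or the limit of a sequence of reductions of `w`. -/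
def ReducesTo (P : Set (ι → K⟦X⟧)) (w w' : ι → K⟦X⟧) : Prop :=
  ∃ s : ℕ → ι → K⟦X⟧, s 0 = w ∧
    (∀ n, (∃ k, KReduces P k (s n) (s (n + 1))) ∨ s (n + 1) = s n) ∧
    (∀ N : ℕ, ∃ m, ∀ n, m ≤ n → ∀ i, (N : ℕ∞) ≤ (s n i - w' i).order)

theorem monotone_order_of_reduces {P : Set (ι → K⟦X⟧)} {s : ℕ → ι → K⟦X⟧}
    (hs : ∀ n, (∃ k, KReduces P k (s n) (s (n + 1))) ∨ s (n + 1) = s n) (i : ι) :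
    Monotone fun n => (s n i).order := by
  refine monotone_nat_of_le_succ fun n => ?_
  rcases hs n with ⟨k, hk⟩ | h
  · exact hk.2.2.1 i
  · rw [h]

/-- If every reduction in an infinite sequence is made at the least possible value, then the sequence
converges to an element without reductions. -/
theorem exists_limit_of_greedy [Finite ι] {P : Set (ι → K⟦X⟧)} (hP : FiniteBelow P)
    (s : ℕ → ι → K⟦X⟧) (k : ℕ → ι) (hk : ∀ n, KReduces P (k n) (s n) (s (n + 1)))
    (hmin : ∀ n j, (∃ w', KReduces P j (s n) w') → (s n (k n)).order ≤ (s n j).order) :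
    ∃ w' : ι → K⟦X⟧, (∀ N : ℕ, ∃ m, ∀ n, m ≤ n → ∀ i, (N : ℕ∞) ≤ (s n i - w' i).order) ∧
      ∀ j w'', ¬ KReduces P j w' w'' := by
  have := Fintype.ofFinite ι
  have hmono := monotone_order_of_reduces fun n => Or.inl ⟨k n, hk n⟩
  -- A component whose value has become stationary is not reduced again, so the values at which
  -- reductions are made tend to infinity.
  have hlarge : ∀ N : ℕ, ∃ m, ∀ n, m ≤ n → (N : ℕ∞) ≤ (s n (k n)).order := by
    intro N
    choose M hM using fun i => exists_eventually_stable (hmono i) N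
    refine ⟨Finset.univ.sup M, fun n hn => ?_⟩
    have hMn : M (k n) ≤ n := (Finset.le_sup (Finset.mem_univ _)).trans hn
    rcases hM (k n) with h | h
    · exact h n hMn
    · have hlt := (hk n).2.2.2
      have h1 : (s n (k n)).order = _ := h n hMn
      have h2 : (s (n + 1) (k n)).order = _ := h (n + 1) (hMn.trans n.le_succ)
      rw [h1, h2] at hlt
      exact absurd hlt (lt_irrefl _)
  -- The subtracted p shares a large finite value with `s n`, so all its values are large.
  have hcauchy : ∀ N : ℕ, ∃ m, ∀ n, m ≤ n → ∀ i, (N : ℕ∞) ≤ (s (n + 1) i - s n i).order := by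
    intro N
    obtain ⟨B, hB⟩ := hP.exists_bound N
    obtain ⟨m, hm⟩ := hlarge B
    refine ⟨m, fun n hn i => ?_⟩
    obtain ⟨c, p, hp, he, -, hpk⟩ := (hk n).exists_eq
    have hdiff : s (n + 1) i - s n i = - (c • p i) := by
      rw [he]
      simp
    rw [hdiff, PowerSeries.order_neg]
    refine le_order_smul_of_le c ?_
    by_contra hlt
    have h1 := hB p hp ⟨i, (not_le.mp hlt).le⟩ (k n) (by rw [hpk]; exact (hk n).1)
    rw [hpk] at h1
    exact absurd (hm n hn) (not_le.mpr h1)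
  obtain ⟨w', hw'⟩ := exists_limit s hcauchy
  refine ⟨w', hw', fun j w'' hred => ?_⟩
  obtain ⟨c, p, hp, -, hle, hpj⟩ := hred.exists_eq
  obtain ⟨N, hN⟩ : ∃ N : ℕ, ∀ i, (w' i).order ≠ ⊤ → (w' i).order < (N : ℕ∞) := by
    refine ⟨Finset.univ.sup (fun i => (w' i).order.toNat) + 1, fun i hi => ?_⟩
    rw [← ENat.natCast_toNat hi]
    exact_mod_cast Nat.lt_succ_of_le
      (Finset.le_sup (f := fun i => (w' i).order.toNat) (Finset.mem_univ i))
  obtain ⟨m₁, hm₁⟩ := hw' N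
  obtain ⟨m₂, hm₂⟩ := hlarge N
  set n := max m₁ m₂
  have hval : ∀ i, (w' i).order ≠ ⊤ → (s n i).order = (w' i).order := by
    intro i hi
    have h1 : (w' i).order < (w' i - s n i).order := by
      rw [← neg_sub, PowerSeries.order_neg]
      exact (hN i hi).trans_le (hm₁ n (le_max_left _ _) i)
    have h2 := order_sub_eq_of_lt h1
    rwa [sub_sub_cancel] at h2
  -- Where the limit is nonzero, `s n` has the same values; where it vanishes, so does p. Hence p
  -- also reduces `s n`, at a value smaller than the greedy one.
  have hsred : ∃ v, KReduces P j (s n) v := by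
    refine KReduces.exists_of_order hp ?_ (fun i => ?_) ?_
    · rw [hval j hred.1]
      exact hred.1
    · by_cases hi : (w' i).order = ⊤
      · have := hle i
        rw [hi, top_le_iff] at this
        rw [this]
        exact le_top
      · rw [hval i hi]
        exact hle i
    · rw [hval j hred.1, hpj]
  have h1 := hmin n j hsred
  rw [hval j hred.1] at h1
  exact absurd ((hm₂ n (le_max_right _ _)).trans h1) (not_le.mpr (hN j hred.1))

theorem exists_final_reduction [Finite ι] {P : Set (ι → K⟦X⟧)} (hP : FiniteBelow P)
    (w : ι → K⟦X⟧) :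
    ∃ w', ReducesTo P w w' ∧ ∀ k w'', ¬ KReduces P k w' w'' := by
  classical
  have hnext : ∀ v : ι → K⟦X⟧, ∃ v', (∃ k, KReduces P k v v' ∧
      ∀ j, (∃ u, KReduces P j v u) → (v k).order ≤ (v j).order) ∨
      (v' = v ∧ ∀ k u, ¬ KReduces P k v u) := by
    intro v
    by_cases h : ∃ k u, KReduces P k v u
    · obtain ⟨k, ⟨u, hu⟩, hk⟩ := Set.exists_min_image {k | ∃ u, KReduces P k v u}
        (fun k => (v k).order) (Set.toFinite _) h
      exact ⟨u, Or.inl ⟨k, hu, fun j hj => hk j hj⟩⟩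
    · push Not at h
      exact ⟨v, Or.inr ⟨rfl, h⟩⟩
  choose next hnext using hnext
  let s : ℕ → ι → K⟦X⟧ := fun n => next^[n] w
  have hs : ∀ n, s (n + 1) = next (s n) := fun n => Function.iterate_succ_apply' next n w
  have hstep : ∀ n, (∃ k, KReduces P k (s n) (s (n + 1))) ∨ s (n + 1) = s n := by
    intro n
    rw [hs n]
    rcases hnext (s n) with ⟨k, hk, -⟩ | ⟨h, -⟩
    · exact Or.inl ⟨k, hk⟩
    · exact Or.inr h
  by_cases hirred : ∃ n, ∀ k u, ¬ KReduces P k (s n) u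
  · obtain ⟨n, hn⟩ := hirred
    have hconst : ∀ m, n ≤ m → s m = s n := by
      intro m hm
      induction m, hm using Nat.le_induction with
      | base => rfl
      | succ m hm ih =>
        rcases hstep m with ⟨k, hk⟩ | h
        · rw [ih] at hk
          exact absurd hk (hn k _)
        · rw [h, ih]
    refine ⟨s n, ⟨s, rfl, hstep, fun N => ⟨n, fun m hm i => ?_⟩⟩, hn⟩
    rw [hconst m hm]
    simp
  · push Not at hirred
    have h : ∀ n, ∃ k, KReduces P k (s n) (s (n + 1)) ∧
        ∀ j, (∃ u, KReduces P j (s n) u) → (s n k).order ≤ (s n j).order := by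
      intro n
      rw [hs n]
      rcases hnext (s n) with h | ⟨-, h⟩
      · exact h
      · obtain ⟨k, u, hu⟩ := hirred n
        exact absurd hu (h k u)
    choose k hk hmin using h
    obtain ⟨w', hw', hirr⟩ := exists_limit_of_greedy hP s k hk hmin
    exact ⟨w', ⟨s, rfl, hstep, hw'⟩, hirr⟩

theorem ReducesTo.order_le {P : Set (ι → K⟦X⟧)} {w w' : ι → K⟦X⟧} (h : ReducesTo P w w') (i : ι) :
    (w i).order ≤ (w' i).order := by
  obtain ⟨s, rfl, hs, hlim⟩ := h
  refine ENat.forall_natCast_le_iff_le.mp fun N hN => ?_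
  obtain ⟨m, hm⟩ := hlim N
  have h1 := hm m le_rfl i
  have h2 := hN.trans (monotone_order_of_reduces hs i (Nat.zero_le m))
  have h3 := le_order_sub_of_le h2 h1
  rwa [sub_sub_cancel] at h3

/-- The `K`-span of the elements of `P` whose values are at least `γ`. -/
def spanAbove (P : Set (ι → K⟦X⟧)) (γ : ι → ℕ∞) : Submodule K (ι → K⟦X⟧) :=
  Submodule.span K {p ∈ P | ∀ i, γ i ≤ (p i).order}

theorem spanAbove_mono {P Q : Set (ι → K⟦X⟧)} (hPQ : P ⊆ Q) {γ δ : ι → ℕ∞} (h : γ ≤ δ) :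
    spanAbove P δ ≤ spanAbove Q γ :=
  Submodule.span_mono fun _ hp => ⟨hPQ hp.1, fun i => (h i).trans (hp.2 i)⟩

/-- Stopping the sequence late leaves a finite sum of subtracted terms, whose values are at least
those of w because values only increase along the sequence. -/
theorem ReducesTo.exists_mem_spanAbove {P : Set (ι → K⟦X⟧)} {w w' : ι → K⟦X⟧}
    (h : ReducesTo P w w') (N : ℕ) :
    ∃ u : ι → K⟦X⟧, (∀ i, (N : ℕ∞) ≤ (u i).order) ∧
      w - w' - u ∈ spanAbove P fun i => (w i).order := by
  obtain ⟨s, rfl, hs, hlim⟩ := h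
  have key : ∀ n, s 0 - s n ∈ spanAbove P fun i => (s 0 i).order := by
    intro n
    induction n with
    | zero => simp
    | succ n ih =>
      rcases hs n with ⟨k, hk⟩ | h
      · obtain ⟨c, p, hp, he, hle, -⟩ := hk.exists_eq
        have : s 0 - s (n + 1) = (s 0 - s n) + c • p := by rw [he]; abel
        rw [this]
        exact add_mem ih (Submodule.smul_mem _ _ (Submodule.subset_span ⟨hp, fun i =>
          (monotone_order_of_reduces hs i (Nat.zero_le n)).trans (hle i)⟩))
      · rwa [h]
  obtain ⟨m, hm⟩ := hlim N
  refine ⟨s m - w', hm m le_rfl, ?_⟩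
  rw [sub_sub_sub_cancel_right]
  exact key m

end Reduction

/-! ### Expansions with respect to elements of consecutive orders -/

section Completeness

variable {K : Type*} [Field K]

theorem exists_coeff_expansion {e : ℕ} {B : ℕ → K⟦X⟧} (hB : ∀ n, (B n).order = ((e + n : ℕ) : ℕ∞))
    {w : K⟦X⟧} (hw : (e : ℕ∞) ≤ w.order) :
    ∃ c : ℕ → K, ∀ n, ((e + n : ℕ) : ℕ∞) ≤ (w - ∑ i ∈ Finset.range n, c i • B i).order := by
  let q : ℕ → K⟦X⟧ → K := fun n v => PowerSeries.coeff (e + n) v / PowerSeries.coeff (e + n) (B n)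
  let v : ℕ → K⟦X⟧ := fun n => Nat.rec w (fun n v => v - q n v • B n) n
  have hv : ∀ n, v (n + 1) = v n - q n (v n) • B n := fun n => rfl
  have hsum : ∀ n, v n = w - ∑ i ∈ Finset.range n, q i (v i) • B i := by
    intro n
    induction n with
    | zero => simp [v]
    | succ n ih => rw [Finset.sum_range_succ, hv, ← sub_sub, ← ih]
  refine ⟨fun n => q n (v n), fun n => ?_⟩
  rw [← hsum]
  induction n with
  | zero => exact hw
  | succ n ih =>
    have hne := (PowerSeries.order_eq_nat.mp (hB n)).1
    have h1 : ((e + n : ℕ) : ℕ∞) < (v (n + 1)).order := by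
      rw [hv]
      refine natCast_lt_order_of_coeff_eq_zero
        (le_order_sub_of_le ih (le_order_smul_of_le _ (hB n).ge)) ?_
      rw [map_sub, PowerSeries.coeff_smul, smul_eq_mul, div_mul_cancel₀ _ hne, sub_self]
    have h2 := Order.add_one_le_of_lt h1
    exact_mod_cast h2

theorem sum_range_mul_eq {M : Type*} [AddCommMonoid M] (F : ℕ → M) (e k : ℕ) :
    ∑ i ∈ Finset.range (k * e), F i =
      ∑ j ∈ Finset.range e, ∑ q ∈ Finset.range k, F (q * e + j) := by
  rw [Finset.sum_comm]
  induction k with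
  | zero => simp
  | succ k ih =>
    rw [Finset.sum_range_succ, ← ih, Nat.succ_mul, Finset.sum_range_add]

/-- With a = ψ(X), the products b_j a^q have order e + j + qe, which takes each value from e on
exactly once. So w expands in them, and collecting terms by residue modulo e gives the series P_j.
No continuity of ψ is assumed: ψ(X^k Q) is divisible by a^k. -/
theorem exists_sum_mul_map {e : ℕ} (he : 0 < e) (ψ : K⟦X⟧ →ₐ[K] K⟦X⟧)
    (hψ : (ψ PowerSeries.X).order = (e : ℕ∞)) {b : ℕ → K⟦X⟧}
    (hb : ∀ j < e, (b j).order = ((e + j : ℕ) : ℕ∞)) {w : K⟦X⟧} (hw : (e : ℕ∞) ≤ w.order) :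
    ∃ P : ℕ → K⟦X⟧, w = ∑ j ∈ Finset.range e, b j * ψ (P j) := by
  set a := ψ PowerSeries.X with ha
  obtain ⟨c, hc⟩ := exists_coeff_expansion (e := e) (B := fun n => b (n % e) * a ^ (n / e)) (by
    intro n
    rw [PowerSeries.order_mul, PowerSeries.order_pow, hψ, hb _ (Nat.mod_lt n he), nsmul_eq_mul]
    norm_cast
    rw [add_assoc, mul_comm (n / e), Nat.mod_add_div]) hw
  refine ⟨fun j => PowerSeries.mk fun q => c (q * e + j), ?_⟩
  rw [← sub_eq_zero, ← PowerSeries.order_eq_top, ENat.eq_top_iff_forall_ge]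
  intro k
  have hpart : ∑ i ∈ Finset.range (k * e), c i • (b (i % e) * a ^ (i / e)) =
      ∑ j ∈ Finset.range e, b j * ψ (∑ q ∈ Finset.range k, c (q * e + j) • PowerSeries.X ^ q) := by
    rw [sum_range_mul_eq]
    refine Finset.sum_congr rfl fun j hj => ?_
    rw [map_sum, Finset.mul_sum]
    refine Finset.sum_congr rfl fun q _ => ?_
    have hj' := Finset.mem_range.mp hj
    have h1 : (q * e + j) % e = j := by
      rw [mul_comm, Nat.mul_add_mod, Nat.mod_eq_of_lt hj']
    have h2 : (q * e + j) / e = q := by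
      rw [mul_comm, Nat.mul_add_div he, Nat.div_eq_of_lt hj', add_zero]
    rw [h1, h2, map_smul, map_pow, mul_smul_comm]
  have htail : ∀ j, ((k : ℕ) : ℕ∞) ≤ (b j * ψ ((PowerSeries.mk fun q => c (q * e + j)) -
      ∑ q ∈ Finset.range k, c (q * e + j) • PowerSeries.X ^ q)).order := by
    intro j
    obtain ⟨Q, hQ⟩ : (PowerSeries.X : K⟦X⟧) ^ k ∣ (PowerSeries.mk fun q => c (q * e + j)) -
        ∑ q ∈ Finset.range k, c (q * e + j) • PowerSeries.X ^ q := by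
      rw [PowerSeries.X_pow_dvd_iff]
      intro m hm
      simp [PowerSeries.coeff_X_pow, hm]
    rw [hQ, map_mul, map_pow, PowerSeries.order_mul, PowerSeries.order_mul, PowerSeries.order_pow,
      hψ, nsmul_eq_mul]
    refine le_trans ?_ (le_trans le_self_add le_add_self)
    exact_mod_cast Nat.le_mul_of_pos_right k he
  have hsplit : w - ∑ j ∈ Finset.range e, b j * ψ (PowerSeries.mk fun q => c (q * e + j)) =
      (w - ∑ i ∈ Finset.range (k * e), c i • (b (i % e) * a ^ (i / e))) -
      ∑ j ∈ Finset.range e, b j * ψ ((PowerSeries.mk fun q => c (q * e + j)) -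
        ∑ q ∈ Finset.range k, c (q * e + j) • PowerSeries.X ^ q) := by
    rw [hpart, sub_sub, ← Finset.sum_add_distrib]
    congr 1
    refine Finset.sum_congr rfl fun j _ => ?_
    rw [map_sub]
    ring
  rw [hsplit]
  refine le_order_sub_of_le (le_trans ?_ (hc (k * e))) ?_
  · exact_mod_cast (Nat.le_mul_of_pos_right k he).trans (Nat.le_add_left _ _)
  · generalize Finset.range e = S
    induction S using Finset.induction_on with
    | empty => simp
    | insert j S hj ih =>
      rw [Finset.sum_insert hj]
      exact le_order_add_of_le (htail j) ih

end Completeness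

namespace ParamPlaneCurve

/-! ### The local ring of a single branch -/

section Branch

variable {K : Type*} [Field K]

theorem constantCoeff_map (φ : MvPowerSeries (Fin 2) K →ₐ[K] K⟦X⟧) (h : MvPowerSeries (Fin 2) K) :
    PowerSeries.constantCoeff (φ h) = MvPowerSeries.constantCoeff h := by
  obtain ⟨c, h₁, h₂, rfl⟩ := exists_decomp h
  have hC : φ (MvPowerSeries.C c) = PowerSeries.C c := by
    rw [MvPowerSeries.c_eq_algebraMap, AlgHom.commutes, PowerSeries.algebraMap_apply]
    rfl
  simp [hC, constantCoeff_map_X]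

/-- The local ring of a branch contains every power series whose order is at least the conductor of its
semigroup of values. -/
theorem exists_map_eq_of_le_order (φ : MvPowerSeries (Fin 2) K →ₐ[K] K⟦X⟧) {μ : ℕ}
    (hμ : ∀ n : ℕ, μ ≤ n → ∃ h, (φ h).order = (n : ℕ∞)) {w : K⟦X⟧} (hw : (μ : ℕ∞) ≤ w.order) :
    ∃ h, φ h = w := by
  -- Positivity of e puts `b e` in the maximal ideal, so that it can be substituted into power
  -- series in one variable.
  have pos : ∀ e : ℕ, 0 < e → μ ≤ e → ∀ w : K⟦X⟧, (e : ℕ∞) ≤ w.order → ∃ h, φ h = w := by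
    intro e he hμe w hw
    choose! b hb using hμ
    have hb0 : MvPowerSeries.constantCoeff (b e) = 0 := by
      rw [← constantCoeff_map φ, ← PowerSeries.order_ne_zero_iff_constCoeff_eq_zero, hb e hμe]
      exact_mod_cast he.ne'
    have hs : PowerSeries.HasSubst (b e) := PowerSeries.HasSubst.of_constantCoeff_zero hb0
    obtain ⟨P, hP⟩ := exists_sum_mul_map he (φ.comp (PowerSeries.substAlgHom hs))
      (by rw [AlgHom.comp_apply, PowerSeries.substAlgHom_X, hb e hμe])
      (b := fun j => φ (b (e + j))) (fun j _ => hb _ (hμe.trans (Nat.le_add_right _ _))) hw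
    refine ⟨∑ j ∈ Finset.range e, b (e + j) * PowerSeries.substAlgHom hs (P j), ?_⟩
    rw [hP, map_sum]
    simp only [map_mul, AlgHom.comp_apply]
  rcases Nat.eq_zero_or_pos μ with h0 | h0
  -- For μ = 0 the constant term is split off and e = 1 is used.
  · set c := PowerSeries.constantCoeff w
    obtain ⟨h, hh⟩ := pos 1 one_pos (by omega) (w - PowerSeries.C c) (by
      rw [Nat.cast_one, PowerSeries.one_le_order_iff_constCoeff_eq_zero]
      simp [c])
    refine ⟨h + algebraMap K _ c, ?_⟩
    rw [map_add, hh, AlgHom.commutes, PowerSeries.algebraMap_apply]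
    exact sub_add_cancel _ _
  · exact pos μ h0 le_rfl w hw

theorem prime_of_ker {φ : MvPowerSeries (Fin 2) K →ₐ[K] K⟦X⟧} {f : MvPowerSeries (Fin 2) K}
    (hf : f ≠ 0) (h : RingHom.ker φ = Ideal.span {f}) : Prime f := by
  rw [← Ideal.span_singleton_prime hf, ← h]
  exact RingHom.ker_isPrime _

end Branch

/-! ### The embedding of O in its normalization -/

variable {K : Type*} [Field K] {r : ℕ} (C : ParamPlaneCurve K r)

theorem param_eq_zero_iff (i : Fin r) (h : MvPowerSeries (Fin 2) K) :
    C.param i h = 0 ↔ C.f i ∣ h := by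
  rw [← Ideal.mem_span_singleton, ← C.ker_param i]
  exact Iff.rfl

theorem prime_f (i : Fin r) : Prime (C.f i) :=
  prime_of_ker (C.irreducible_f i).ne_zero (C.ker_param i)

theorem not_dvd_f {i j : Fin r} (hij : i ≠ j) : ¬ C.f i ∣ C.f j := fun h =>
  have : IsDomain (MvPowerSeries (Fin 2) K) := NoZeroDivisors.to_isDomain _
  C.span_ne i j hij (Ideal.span_singleton_eq_span_singleton.mpr
    ((C.irreducible_f i).associated_of_dvd (C.irreducible_f j) h))

theorem prod_f_dvd (s : Finset (Fin r)) (h : MvPowerSeries (Fin 2) K) (hs : ∀ i ∈ s, C.f i ∣ h) :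
    ∏ i ∈ s, C.f i ∣ h := by
  induction s using Finset.induction_on generalizing h with
  | empty => simp
  | insert i s hi ih =>
    obtain ⟨q, rfl⟩ := hs i (Finset.mem_insert_self i s)
    rw [Finset.prod_insert hi]
    refine mul_dvd_mul_left _ (ih q fun j hj => ?_)
    have hji : j ≠ i := fun h => hi (h ▸ hj)
    exact ((C.prime_f j).dvd_or_dvd (hs j (Finset.mem_insert_of_mem hj))).resolve_left
      (C.not_dvd_f hji)

theorem psi_cls (h : MvPowerSeries (Fin 2) K) (i : Fin r) : C.psi (C.cls h) i = C.param i h := rfl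

theorem cls_surjective : Function.Surjective C.cls := Ideal.Quotient.mk_surjective

theorem psi_injective : Function.Injective C.psi := by
  rw [injective_iff_map_eq_zero]
  intro g hg
  obtain ⟨h, rfl⟩ := C.cls_surjective g
  refine Ideal.Quotient.eq_zero_iff_mem.mpr (Ideal.mem_span_singleton.mpr ?_)
  exact C.prod_f_dvd _ _ fun i _ => (C.param_eq_zero_iff i h).mp (congrFun hg i)

theorem one_le_order_psi {g : C.LocalRing} (hg : g ∈ nonunits C.LocalRing) (i : Fin r) :
    1 ≤ (C.psi g i).order := by
  obtain ⟨h, rfl⟩ := C.cls_surjective g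
  rw [psi_cls, PowerSeries.one_le_order_iff_constCoeff_eq_zero, constantCoeff_map]
  by_contra hc
  exact hg (((MvPowerSeries.isUnit_iff_constantCoeff).mpr (IsUnit.mk0 _ hc)).map C.cls)

/-! ### The conductor -/

/-- Writing t = a/b with a, b in the branch ring produces two consecutive values n and n + 1. -/
theorem exists_nat_branchValues (i : Fin r) :
    ∃ c : ℕ, ∀ n : ℕ, c ≤ n → ∃ h, (C.param i h).order = (n : ℕ∞) := by
  have := C.isFractionRing i
  obtain ⟨⟨_, a, rfl⟩, ⟨_, b, rfl⟩, hb, hab⟩ :=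
    IsFractionRing.div_surjective (A := (C.param i).range)
      (algebraMap K⟦X⟧ K⸨X⸩ PowerSeries.X)
  have hb0 : C.param i b ≠ 0 := fun h => nonZeroDivisors.ne_zero hb (Subtype.ext h)
  have hinj := IsFractionRing.injective K⟦X⟧ K⸨X⸩
  have hX : C.param i a = PowerSeries.X * C.param i b := by
    apply hinj
    rw [map_mul, ← hab]
    refine (div_mul_cancel₀ _ ?_).symm
    exact fun h => hb0 (hinj (h.trans (map_zero _).symm))
  obtain ⟨n, hn⟩ := ENat.ne_top_iff_exists.mp (PowerSeries.order_eq_top.not.mpr hb0)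
  have han : (C.param i a).order = ((n + 1 : ℕ) : ℕ∞) := by
    rw [hX, PowerSeries.order_mul, PowerSeries.order_X, ← hn, add_comm]
    rfl
  refine ⟨n * n, fun m hm => ?_⟩
  rcases Nat.eq_zero_or_pos n with h0 | h0
  · refine ⟨a ^ m, ?_⟩
    rw [map_pow, PowerSeries.order_pow, han, h0]
    simp
  -- m = (m/n - m%n)·n + (m%n)·(n + 1), where m ≥ n² keeps the first coefficient nonnegative.
  · refine ⟨b ^ (m / n - m % n) * a ^ (m % n), ?_⟩
    have h1 : m % n ≤ m / n := (Nat.mod_lt m h0).le.trans ((Nat.le_div_iff_mul_le h0).mpr hm)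
    rw [map_mul, map_pow, map_pow, PowerSeries.order_mul, PowerSeries.order_pow,
      PowerSeries.order_pow, han, ← hn, nsmul_eq_mul, nsmul_eq_mul]
    norm_cast
    obtain ⟨d, hd⟩ := Nat.exists_eq_add_of_le h1
    have h2 := Nat.div_add_mod m n
    rw [hd] at h2 ⊢
    rw [Nat.add_sub_cancel_left]
    nlinarith

theorem exists_order_param_eq (i : Fin r) {n : ℕ} (hn : C.branchConductor i ≤ n) :
    ∃ h, (C.param i h).order = (n : ℕ∞) :=
  Nat.sInf_mem (s := {c : ℕ | ∀ n : ℕ, c ≤ n → (n : ℕ∞) ∈ C.branchValues i})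
    (C.exists_nat_branchValues i) n hn

theorem branchConductor_le {i : Fin r} {c : ℕ}
    (hc : ∀ n : ℕ, c ≤ n → ∃ h, (C.param i h).order = (n : ℕ∞)) : C.branchConductor i ≤ c :=
  Nat.sInf_le hc

/-- The equation of the union of the branches other than the `i`-th one. -/
def cofactor (i : Fin r) : MvPowerSeries (Fin 2) K := ∏ j ∈ Finset.univ.erase i, C.f j

/-- The order of the cofactor on the `i`-th branch, which is the intersection multiplicity of this branch
with the union of the others. -/
def cofactorOrder (i : Fin r) : ℕ := (C.param i (C.cofactor i)).order.toNat

theorem param_cofactor_ne_zero (i : Fin r) : C.param i (C.cofactor i) ≠ 0 := by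
  rw [cofactor, map_prod, Finset.prod_ne_zero_iff]
  intro j hj h
  exact C.not_dvd_f (Finset.ne_of_mem_erase hj).symm ((C.param_eq_zero_iff i _).mp h)

theorem param_cofactor_of_ne {i j : Fin r} (hij : i ≠ j) : C.param i (C.cofactor j) = 0 :=
  (C.param_eq_zero_iff i _).mpr
    (Finset.dvd_prod_of_mem _ (Finset.mem_erase.mpr ⟨hij, Finset.mem_univ i⟩))

theorem order_param_cofactor (i : Fin r) :
    (C.param i (C.cofactor i)).order = (C.cofactorOrder i : ℕ∞) :=
  (ENat.natCast_toNat (PowerSeries.order_eq_top.not.mpr (C.param_cofactor_ne_zero i))).symm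

/-- The exponents `σᵢ = μᵢ + ∑_{j ≠ i} vᵢ(f_j)` of the conductor. -/
def conductorExponent (i : Fin r) : ℕ := C.branchConductor i + C.cofactorOrder i

theorem conductorExponent_eq (i : Fin r) : (C.conductorExponent i : ℕ∞) =
    (C.branchConductor i : ℕ∞) + ∑ j ∈ Finset.univ.erase i, (C.param i (C.f j)).order := by
  rw [conductorExponent, Nat.cast_add, ← order_param_cofactor, cofactor, map_prod,
    PowerSeries.order_prod]

/-- The cofactor of a branch vanishes on all other branches, so each component can be lifted
separately; division by the image of the cofactor leaves order at least μᵢ. -/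
theorem mem_range_psi_of_le_order {w : Fin r → K⟦X⟧}
    (hw : ∀ i, (C.conductorExponent i : ℕ∞) ≤ (w i).order) : w ∈ Set.range C.psi := by
  have key : ∀ i, ∃ h, C.param i (C.cofactor i * h) = w i := by
    intro i
    obtain ⟨u, hu⟩ := (PowerSeries.X_pow_dvd_iff (n := C.cofactorOrder i)).mpr
      (natCast_le_order_iff.mp ((by exact_mod_cast Nat.le_add_left _ _ :
        (C.cofactorOrder i : ℕ∞) ≤ C.conductorExponent i).trans (hw i)))
    obtain ⟨v, hv⟩ := PowerSeries.X_pow_order_dvd (φ := C.param i (C.cofactor i))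
    change _ = PowerSeries.X ^ C.cofactorOrder i * v at hv
    have hvo : v.order = 0 := by
      have h := congrArg PowerSeries.order hv
      rw [PowerSeries.order_mul, PowerSeries.order_X_pow, order_param_cofactor] at h
      by_contra h0
      have h1 : (1 : ℕ∞) ≤ v.order := Order.one_le_iff_ne_zero.mpr h0
      have h2 : ((C.cofactorOrder i + 1 : ℕ) : ℕ∞) ≤ C.cofactorOrder i := by
        conv_rhs => rw [h]
        rw [Nat.cast_add, Nat.cast_one]
        exact add_le_add_right h1 _
      exact absurd (by exact_mod_cast h2) (Nat.not_succ_le_self (C.cofactorOrder i))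
    have hvu : v * v⁻¹ = 1 := by
      refine PowerSeries.mul_inv_cancel v fun h => ?_
      exact (PowerSeries.order_ne_zero_iff_constCoeff_eq_zero.mpr h) hvo
    have hle : (C.branchConductor i : ℕ∞) ≤ (u * v⁻¹).order := by
      have h := hw i
      rw [hu, PowerSeries.order_mul, PowerSeries.order_X_pow, conductorExponent, Nat.cast_add,
        add_comm] at h
      rw [PowerSeries.order_mul]
      exact ((ENat.add_le_add_iff_left (ENat.natCast_ne_top _)).mp h).trans le_self_add
    obtain ⟨h, hh⟩ := exists_map_eq_of_le_order (C.param i)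
      (fun n hn => C.exists_order_param_eq i hn) hle
    refine ⟨h, ?_⟩
    rw [map_mul, hh, hv, hu]
    linear_combination (PowerSeries.X ^ C.cofactorOrder i * u) * hvu
  choose h hh using key
  refine ⟨C.cls (∑ j, C.cofactor j * h j), ?_⟩
  funext i
  rw [psi_cls, map_sum, Finset.sum_eq_single i, hh]
  · intro j _ hji
    rw [map_mul, C.param_cofactor_of_ne hji.symm, zero_mul]
  · simp

theorem isConductor_conductorExponent : C.IsConductor C.conductorExponent := by
  ext c
  refine ⟨fun hc i => ?_, fun hc b => C.mem_range_psi_of_le_order fun i => ?_⟩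
  · by_cases ht : (c i).order = ⊤
    · rw [ht]
      exact le_top
    obtain ⟨n, hn⟩ := ENat.ne_top_iff_exists.mp ht
    -- The tuple c·t^(m-n) supported on branch i comes from a multiple of the cofactor, and the
    -- quotient has the missing value.
    have key : ∀ m : ℕ, n ≤ m → ∃ h, (C.cofactorOrder i : ℕ∞) + (C.param i h).order = m := by
      intro m hm
      obtain ⟨g, hg⟩ := hc (Pi.single i (PowerSeries.X ^ (m - n)))
      obtain ⟨h, rfl⟩ := C.cls_surjective g
      obtain ⟨q, rfl⟩ : C.cofactor i ∣ h := by
        refine C.prod_f_dvd _ _ fun j hj => (C.param_eq_zero_iff j h).mp ?_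
        rw [← psi_cls, hg, Pi.mul_apply, Pi.single_eq_of_ne (Finset.ne_of_mem_erase hj), mul_zero]
      refine ⟨q, ?_⟩
      have h1 := congrArg PowerSeries.order (congrFun hg i)
      rw [psi_cls, map_mul, PowerSeries.order_mul, order_param_cofactor, Pi.mul_apply,
        Pi.single_eq_same, PowerSeries.order_mul, PowerSeries.order_X_pow, ← hn] at h1
      rw [h1]
      exact_mod_cast Nat.add_sub_of_le hm
    have hle : C.cofactorOrder i ≤ n := by
      obtain ⟨h, hh⟩ := key n le_rfl
      exact_mod_cast hh ▸ (le_self_add : (C.cofactorOrder i : ℕ∞) ≤ _ + (C.param i h).order)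
    have hbr : C.branchConductor i ≤ n - C.cofactorOrder i := by
      refine C.branchConductor_le fun m hm => ?_
      obtain ⟨h, hh⟩ := key (C.cofactorOrder i + m) (by omega)
      rw [Nat.cast_add] at hh
      exact ⟨h, ENat.add_right_injective_of_ne_top (ENat.natCast_ne_top _) hh⟩
    rw [← hn, conductorExponent]
    exact_mod_cast (by omega : C.branchConductor i + C.cofactorOrder i ≤ n)
  · rw [Pi.mul_apply, PowerSeries.order_mul]
    exact (hc i).trans le_self_add

/-! ### The fractional ideal of differentials -/

/-- The derivation `t d/dt` in each component. -/
def euler : (Fin r → K⟦X⟧) →ₗ[K] (Fin r → K⟦X⟧) where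
  toFun w i := PowerSeries.X * PowerSeries.derivative K (w i)
  map_add' a b := by
    funext i
    simp [mul_add]
  map_smul' c a := by
    funext i
    simp

theorem euler_apply (w : Fin r → K⟦X⟧) (i : Fin r) :
    euler w i = PowerSeries.X * PowerSeries.derivative K (w i) := rfl

theorem coeff_euler (w : Fin r → K⟦X⟧) (i : Fin r) (n : ℕ) :
    PowerSeries.coeff n (euler w i) = n * PowerSeries.coeff n (w i) := by
  rw [euler_apply]
  cases n with
  | zero => simp
  | succ n =>
    rw [PowerSeries.coeff_succ_X_mul, PowerSeries.coeff_derivative, mul_comm]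
    push_cast
    rfl

theorem euler_mul (a b : Fin r → K⟦X⟧) : euler (a * b) = a * euler b + b * euler a := by
  funext i
  simp only [euler_apply, Pi.mul_apply, Pi.add_apply, Derivation.leibniz, smul_eq_mul]
  ring

theorem euler_one : euler (1 : Fin r → K⟦X⟧) = 0 := by
  funext i
  simp [euler_apply]

theorem le_order_euler {a : ℕ∞} {w : Fin r → K⟦X⟧} {i : Fin r} (h : a ≤ (w i).order) :
    a ≤ (euler w i).order := by
  refine PowerSeries.le_order _ _ fun j hj => ?_
  rw [coeff_euler, PowerSeries.coeff_of_lt_order j (hj.trans_le h), mul_zero]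

theorem order_euler [CharZero K] {w : Fin r → K⟦X⟧} {i : Fin r} (h : 1 ≤ (w i).order) :
    (euler w i).order = (w i).order := by
  refine le_antisymm ?_ (le_order_euler le_rfl)
  refine PowerSeries.le_order _ _ fun j hj => ?_
  have := PowerSeries.coeff_of_lt_order j hj
  rw [coeff_euler, mul_eq_zero] at this
  rcases this with h0 | h0
  · have hj0 : j = 0 := by exact_mod_cast h0
    subst hj0
    exact PowerSeries.coeff_of_lt_order 0 (lt_of_lt_of_le (by simp) h)
  · exact h0

theorem pullback_d (g : C.LocalRing) : C.pullback (C.d g) = euler (C.psi g) := by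
  obtain ⟨h, rfl⟩ := C.cls_surjective g
  funext i
  rw [euler_apply, psi_cls, derivative_param]
  rfl

theorem exists_pullback_eq (ω : C.Omega) : ∃ p q : C.LocalRing, C.pullback ω =
    C.psi p * euler (C.psi (C.cls (MvPowerSeries.X 0))) +
      C.psi q * euler (C.psi (C.cls (MvPowerSeries.X 1))) := by
  obtain ⟨⟨p, q⟩, rfl⟩ := Submodule.Quotient.mk_surjective _ ω
  refine ⟨p, q, ?_⟩
  funext i
  change PowerSeries.X * (C.psi p i * PowerSeries.derivative K (C.param i (MvPowerSeries.X 0)) +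
    C.psi q i * PowerSeries.derivative K (C.param i (MvPowerSeries.X 1))) = _
  simp only [Pi.add_apply, Pi.mul_apply, euler_apply, psi_cls]
  ring

theorem smul_eq_psi_mul (c : K) (w : Fin r → K⟦X⟧) :
    c • w = C.psi (C.cls (algebraMap K _ c)) * w := by
  funext i
  rw [Pi.mul_apply, psi_cls, AlgHom.commutes, ← Algebra.smul_def]
  rfl

/-- The range of `φ*` as a vector space over `K`. -/
def differentials : Submodule K (Fin r → K⟦X⟧) where
  carrier := Set.range C.pullback
  add_mem' := by
    rintro _ _ ⟨a, rfl⟩ ⟨b, rfl⟩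
    exact ⟨a + b, map_add _ _ _⟩
  zero_mem' := ⟨0, map_zero _⟩
  smul_mem' := by
    rintro c _ ⟨a, rfl⟩
    exact ⟨C.cls (algebraMap K _ c) • a, by rw [LinearMap.map_smulₛₗ, C.smul_eq_psi_mul]; rfl⟩

theorem psi_mul_mem_differentials (g : C.LocalRing) {w : Fin r → K⟦X⟧} (hw : w ∈ C.differentials) :
    C.psi g * w ∈ C.differentials := by
  obtain ⟨a, rfl⟩ := hw
  exact ⟨g • a, by rw [LinearMap.map_smulₛₗ]; rfl⟩

theorem one_le_order_of_mem_differentials {w : Fin r → K⟦X⟧} (hw : w ∈ C.differentials) (i : Fin r) :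
    1 ≤ (w i).order := by
  obtain ⟨a, rfl⟩ := hw
  obtain ⟨p, q, h⟩ := C.exists_pullback_eq a
  rw [h, PowerSeries.one_le_order_iff_constCoeff_eq_zero]
  simp [euler_apply]

/-- Such a w is exact: dividing the n-th coefficients by n inverts t d/dt, and the result lies in O
by the conductor. The bound by 1 excludes constant terms, which matters where the exponent is 0. -/
theorem mem_differentials_of_le_order [CharZero K] {w : Fin r → K⟦X⟧}
    (hσ : ∀ i, (C.conductorExponent i : ℕ∞) ≤ (w i).order) (h1 : ∀ i, 1 ≤ (w i).order) :
    w ∈ C.differentials := by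
  obtain ⟨g, hg⟩ := C.mem_range_psi_of_le_order
    (w := fun i => PowerSeries.mk fun n => PowerSeries.coeff n (w i) / n) (fun i => by
      refine natCast_le_order_iff.mpr fun j hj => ?_
      rw [PowerSeries.coeff_mk, natCast_le_order_iff.mp (hσ i) j hj, zero_div])
  refine ⟨C.d g, ?_⟩
  rw [pullback_d, hg]
  funext i
  ext n
  rw [coeff_euler, PowerSeries.coeff_mk]
  rcases Nat.eq_zero_or_pos n with rfl | hn
  · have := PowerSeries.one_le_order_iff_constCoeff_eq_zero.mp (h1 i)
    simpa using this.symm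
  · exact mul_div_cancel₀ _ (by exact_mod_cast hn.ne')

/-- The fractional ideal of differentials is closed. -/
theorem mem_differentials_of_limit [CharZero K] {w : Fin r → K⟦X⟧}
    (h : ∀ N : ℕ, ∃ u : Fin r → K⟦X⟧, (∀ i, (N : ℕ∞) ≤ (u i).order) ∧ w - u ∈ C.differentials) :
    w ∈ C.differentials := by
  -- The added 1 also makes the values of u positive.
  obtain ⟨u, hu, hw⟩ := h (Finset.univ.sup C.conductorExponent + 1)
  rw [← sub_add_cancel w u]
  refine add_mem hw (C.mem_differentials_of_le_order (fun i => ?_) fun i => ?_)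
  · refine le_trans ?_ (hu i)
    exact_mod_cast (Finset.le_sup (Finset.mem_univ i)).trans (Nat.le_succ _)
  · refine le_trans ?_ (hu i)
    exact_mod_cast Nat.le_add_left 1 _

theorem mem_range_psi_of_limit {w : Fin r → K⟦X⟧}
    (h : ∀ N : ℕ, ∃ u : Fin r → K⟦X⟧, (∀ i, (N : ℕ∞) ≤ (u i).order) ∧ w - u ∈ Set.range C.psi) :
    w ∈ Set.range C.psi := by
  obtain ⟨u, hu, ⟨a, ha⟩⟩ := h (Finset.univ.sup C.conductorExponent)
  obtain ⟨b, hb⟩ := C.mem_range_psi_of_le_order (w := u) fun i => by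
    refine le_trans ?_ (hu i)
    exact_mod_cast Finset.le_sup (Finset.mem_univ i)
  exact ⟨a + b, by rw [map_add, ha, hb, sub_add_cancel]⟩

end ParamPlaneCurve

/-! ### A Buchberger criterion modulo tuples of high order -/

section Tail

variable {K : Type*} [Field K] {ι : Type*}

/-- The tuples of power series of order at least `N`. -/
def tail (N : ℕ) : Submodule K (ι → K⟦X⟧) where
  carrier := {w | ∀ i, (N : ℕ∞) ≤ (w i).order}
  add_mem' ha hb i := le_order_add_of_le (ha i) (hb i)
  zero_mem' i := by simp
  smul_mem' c _ ha i := le_order_smul_of_le c (ha i)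

theorem mul_mem_tail {N : ℕ} (a : ι → K⟦X⟧) {w : ι → K⟦X⟧} (hw : w ∈ tail (K := K) N) :
    a * w ∈ tail (K := K) N := fun i => by
  rw [Pi.mul_apply, PowerSeries.order_mul]
  exact (hw i).trans le_add_self

theorem ReducesTo.mem_spanAbove_sup_tail {P : Set (ι → K⟦X⟧)} {w : ι → K⟦X⟧}
    (h : ReducesTo P w 0) (N : ℕ) : w ∈ spanAbove P (fun i => (w i).order) ⊔ tail N := by
  obtain ⟨u, hu, hw⟩ := h.exists_mem_spanAbove N
  rw [sub_zero] at hw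
  exact Submodule.mem_sup.mpr ⟨_, hw, u, hu, sub_add_cancel w u⟩

theorem le_order_of_mem_spanAbove_sup_tail {P : Set (ι → K⟦X⟧)} {γ : ι → ℕ∞} {N : ℕ}
    {w : ι → K⟦X⟧} (hw : w ∈ spanAbove P γ ⊔ tail N) {i : ι} {a : ℕ∞} (ha : a ≤ γ i)
    (haN : a ≤ N) : a ≤ (w i).order := by
  obtain ⟨x, hx, u, hu, rfl⟩ := Submodule.mem_sup.mp hw
  refine le_order_add_of_le (ha.trans ?_) (haN.trans (hu i))
  clear hw
  induction hx using Submodule.span_induction with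
  | mem p hp => exact hp.2 i
  | zero => simp
  | add x y _ _ hx hy => exact le_order_add_of_le hx hy
  | smul c x _ hx => exact le_order_smul_of_le c hx

theorem natCast_update_le [DecidableEq ι] {β : ι → ℕ} {k : ι} {f : ι → ℕ∞}
    (h : ∀ i, (β i : ℕ∞) ≤ f i) (hk : (β k : ℕ∞) < f k) (i : ι) :
    (Function.update β k (β k + 1) i : ℕ∞) ≤ f i := by
  by_cases hi : i = k
  · subst hi
    rw [Function.update_self]
    exact_mod_cast Order.add_one_le_of_lt hk
  · rw [Function.update_of_ne hi]
    exact h i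

theorem spanAbove_sup_tail_mono {P : Set (ι → K⟦X⟧)} {γ δ : ι → ℕ∞} {N : ℕ} (h : ∀ i, γ i ≤ δ i)
    {w : ι → K⟦X⟧} (hw : w ∈ spanAbove P δ ⊔ tail N) : w ∈ spanAbove P γ ⊔ tail N := by
  have hle : spanAbove P δ ⊔ tail (K := K) N ≤ spanAbove P γ ⊔ tail N :=
    sup_le_sup (spanAbove_mono subset_rfl h) le_rfl
  exact hle hw

theorem spanAbove_le_of_forall_order_ne [DecidableEq ι] {P : Set (ι → K⟦X⟧)} {β : ι → ℕ} {k : ι}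
    (h : ∀ p ∈ P, (∀ i, (β i : ℕ∞) ≤ (p i).order) → (p k).order ≠ β k) :
    spanAbove P (fun i => (β i : ℕ∞)) ≤
      spanAbove P fun i => (Function.update β k (β k + 1) i : ℕ∞) := by
  exact Submodule.span_mono fun p hp =>
    ⟨hp.1, natCast_update_le hp.2 (lt_of_le_of_ne (hp.2 k) (h p hp.1 hp.2).symm)⟩

/-- If the differences of elements of `P` in which the leading terms of the `k`-th components cancel are
combinations of elements of `P` with no smaller values, then the lower bound on the `k`-th values
in a representation can be raised to the actual value. -/
theorem mem_spanAbove_update [DecidableEq ι] {P : Set (ι → K⟦X⟧)} {β : ι → ℕ} {k : ι} {N : ℕ}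
    (hN : β k < N)
    (hS : ∀ p ∈ P, ∀ q ∈ P, ∀ c : K, (p k).order = (q k).order → (p k).order ≠ ⊤ →
      (p k).order < ((p - c • q) k).order →
      p - c • q ∈ spanAbove P (fun i => ((p - c • q) i).order) ⊔ tail N)
    {w : ι → K⟦X⟧} (hw : w ∈ spanAbove P (fun i => (β i : ℕ∞)) ⊔ tail N)
    (hwk : (β k : ℕ∞) < (w k).order) :
    w ∈ spanAbove P (fun i => (Function.update β k (β k + 1) i : ℕ∞)) ⊔ tail N := by
  set M := spanAbove P (fun i => (Function.update β k (β k + 1) i : ℕ∞)) ⊔ tail (K := K) N with hM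
  by_cases hq : ∃ q ∈ P, (∀ i, (β i : ℕ∞) ≤ (q i).order) ∧ (q k).order = β k
  · obtain ⟨q, hq, hqβ, hqk⟩ := hq
    -- Modulo M every generator is a multiple of the one element q whose k-th value is minimal.
    have key : ∀ v ∈ spanAbove P (fun i => (β i : ℕ∞)), ∃ c : K, v - c • q ∈ M := by
      intro v hv
      induction hv using Submodule.span_induction with
      | mem p hp =>
        by_cases hpk : (p k).order = β k
        · obtain ⟨c, hc⟩ := exists_lt_order_sub_smul (hpk.trans hqk.symm)
            (by rw [hpk]; exact ENat.natCast_ne_top _)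
          refine ⟨c, spanAbove_sup_tail_mono (natCast_update_le (fun i => le_order_sub_of_le (hp.2 i)
            (le_order_smul_of_le c (hqβ i))) ?_)
            (hS p hp.1 q hq c (hpk.trans hqk.symm) (by rw [hpk]; exact ENat.natCast_ne_top _) hc)⟩
          rwa [hpk] at hc
        · refine ⟨0, ?_⟩
          rw [zero_smul, sub_zero]
          exact Submodule.mem_sup_left (Submodule.subset_span
            ⟨hp.1, natCast_update_le hp.2 (lt_of_le_of_ne (hp.2 k) (Ne.symm hpk))⟩)
      | zero => exact ⟨0, by simp⟩
      | add x y _ _ hx hy =>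
        obtain ⟨a, ha⟩ := hx
        obtain ⟨b, hb⟩ := hy
        refine ⟨a + b, ?_⟩
        rw [add_smul, add_sub_add_comm]
        exact add_mem ha hb
      | smul a x _ hx =>
        obtain ⟨b, hb⟩ := hx
        refine ⟨a * b, ?_⟩
        rw [mul_smul, ← smul_sub]
        exact Submodule.smul_mem _ a hb
    obtain ⟨v, hv, u, hu, rfl⟩ := Submodule.mem_sup.mp hw
    obtain ⟨c, hc⟩ := key v hv
    have hmem : v + u - c • q ∈ M := by
      have := add_mem hc (Submodule.mem_sup_right hu : u ∈ M)
      rwa [sub_add_eq_add_sub] at this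
    -- The k-th values of w and of all elements of M exceed `β k`, while that of q does not.
    have hc0 : c = 0 := by
      by_contra hc0
      have hle : ((β k + 1 : ℕ) : ℕ∞) ≤ ((v + u - c • q) k).order :=
        le_order_of_mem_spanAbove_sup_tail hmem (by rw [Function.update_self])
          (by exact_mod_cast hN)
      have hle' : ((β k + 1 : ℕ) : ℕ∞) ≤ ((v + u) k).order := by
        exact_mod_cast Order.add_one_le_of_lt hwk
      have := le_order_sub_of_le hle' hle
      have he : (v + u) k - (v + u - c • q) k = c • q k := by simp
      rw [he, order_smul_of_ne_zero hc0, hqk] at this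
      exact absurd (by exact_mod_cast this) (Nat.not_succ_le_self (β k))
    rwa [hc0, zero_smul, sub_zero] at hmem
  · push Not at hq
    exact sup_le_sup_right (spanAbove_le_of_forall_order_ne hq) _ hw

/-- A tuple that is, up to terms of high order, a combination of elements of `P` has a reduction
modulo `P` if the cancelling differences have representations with no smaller values. -/
theorem exists_kReduces_of_mem_spanAbove [Finite ι] {P : Set (ι → K⟦X⟧)} (hP : FiniteBelow P)
    (hS : ∀ N : ℕ, ∀ k, ∀ p ∈ P, ∀ q ∈ P, ∀ c : K, (p k).order = (q k).order → (p k).order ≠ ⊤ →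
      (p k).order < ((p - c • q) k).order →
      p - c • q ∈ spanAbove P (fun i => ((p - c • q) i).order) ⊔ tail N)
    {w : ι → K⟦X⟧} (hw0 : w ≠ 0) (hw : ∀ N, w ∈ spanAbove P 0 ⊔ tail N) :
    ∃ k w', KReduces P k w w' := by
  classical
  have := Fintype.ofFinite ι
  obtain ⟨k, hk⟩ : ∃ k, (w k).order ≠ ⊤ := by
    by_contra! h
    exact hw0 (funext fun i => PowerSeries.order_eq_top.mp (h i))
  obtain ⟨A, hA⟩ : ∃ A : ℕ, ∀ i, (w i).order ≠ ⊤ → (w i).order < (A : ℕ∞) := by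
    refine ⟨Finset.univ.sup (fun i => (w i).order.toNat) + 1, fun i hi => ?_⟩
    rw [← ENat.natCast_toNat hi]
    exact_mod_cast Nat.lt_succ_of_le
      (Finset.le_sup (f := fun i => (w i).order.toNat) (Finset.mem_univ i))
  obtain ⟨B, hB⟩ := hP.exists_bound A
  -- A exceeds all finite values of w; elements of P with some value at most A have no finite value
  -- from B on.
  set N := max A B
  let Q : Set (ι → ℕ) := {β | (∀ i, β i ≤ N ∧ (β i : ℕ∞) ≤ (w i).order) ∧
    w ∈ spanAbove P (fun i => (β i : ℕ∞)) ⊔ tail N}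
  have hQfin : Q.Finite :=
    (Set.finite_Icc (0 : ι → ℕ) fun _ => N).subset fun β hβ => ⟨zero_le, fun i => (hβ.1 i).1⟩
  have hQne : Q.Nonempty := ⟨0, fun i => ⟨Nat.zero_le _, by simp⟩, by
    have := hw N
    simpa [Pi.zero_def] using this⟩
  -- For a maximal β no entry below N can still be raised, so each such entry is the actual value of
  -- w.
  obtain ⟨β, hβ, hmax⟩ := Set.exists_max_image Q (fun β => ∑ i, β i) hQfin hQne
  have hsharp : ∀ i, β i < N → (w i).order = β i := by
    intro i hi
    by_contra hne
    have hlt : (β i : ℕ∞) < (w i).order := lt_of_le_of_ne (hβ.1 i).2 (Ne.symm hne)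
    have hnew : Function.update β i (β i + 1) ∈ Q := by
      refine ⟨fun j => ?_, mem_spanAbove_update hi (hS N i) hβ.2 hlt⟩
      by_cases hj : j = i
      · subst hj
        rw [Function.update_self]
        exact ⟨hi, by exact_mod_cast Order.add_one_le_of_lt hlt⟩
      · rw [Function.update_of_ne hj]
        exact hβ.1 j
    have h1 := hmax _ hnew
    rw [Finset.sum_update_of_mem (Finset.mem_univ i)] at h1
    have h2 := Finset.sum_update_of_mem (Finset.mem_univ i) β (β i)
    rw [Function.update_eq_self] at h2
    omega
  have hfin : ∀ i, (w i).order ≠ ⊤ → (w i).order = β i := by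
    intro i hi
    refine hsharp i ?_
    have h1 := (hβ.1 i).2.trans_lt (hA i hi)
    exact lt_of_lt_of_le (by exact_mod_cast h1) (le_max_left _ _)
  have hinf : ∀ i, (w i).order = ⊤ → β i = N := by
    intro i hi
    by_contra hne
    have := hsharp i (lt_of_le_of_ne (hβ.1 i).1 hne)
    rw [hi] at this
    exact ENat.top_ne_natCast _ this
  -- Otherwise all terms of the representation, hence w itself, would have a k-th value above `β k`.
  obtain ⟨p, hp, hpβ, hpk⟩ : ∃ p ∈ P, (∀ i, (β i : ℕ∞) ≤ (p i).order) ∧ (p k).order = β k := by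
    by_contra! hno
    have h1 := sup_le_sup_right (spanAbove_le_of_forall_order_ne hno) (tail N) hβ.2
    have hkN : β k < N := by
      have h1 := (hβ.1 k).2.trans_lt (hA k hk)
      exact lt_of_lt_of_le (by exact_mod_cast h1) (le_max_left _ _)
    have h2 : ((β k + 1 : ℕ) : ℕ∞) ≤ (w k).order :=
      le_order_of_mem_spanAbove_sup_tail h1 (by rw [Function.update_self])
        (by exact_mod_cast hkN)
    rw [hfin k hk] at h2
    exact absurd (by exact_mod_cast h2) (Nat.not_succ_le_self (β k))
  refine ⟨k, KReduces.exists_of_order hp hk (fun i => ?_) (hpk.trans (hfin k hk).symm)⟩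
  by_cases hi : (w i).order = ⊤
  -- The k-th value of p is at most A and its i-th value at least N ≥ B, so the latter is infinite.
  · have h1 : (p i).order = ⊤ := by
      by_contra hne
      have h2 := hB p hp ⟨k, by rw [hpk, ← hfin k hk]; exact (hA k hk).le⟩ i hne
      have h3 := hpβ i
      rw [hinf i hi] at h3
      have h4 : (B : ℕ∞) ≤ (N : ℕ∞) := by exact_mod_cast le_max_right A B
      exact absurd (h2.trans_le (h4.trans h3)) (lt_irrefl _)
    rw [h1]
    exact le_top
  · rw [hfin i hi]
    exact hpβ i

end Tail

/-! ### Products of G-products with elements of H -/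

namespace ParamPlaneCurve

open scoped Pointwise

variable {K : Type*} [Field K] {r : ℕ} (C : ParamPlaneCurve K r)

/-- The products of a `G`-product and an element of `H`. -/
def prods (G : Set C.LocalRing) (H : Set (Fin r → K⟦X⟧)) : Set (Fin r → K⟦X⟧) :=
  {p | ∃ m ∈ Submonoid.closure G, ∃ h ∈ H, p = C.psi m * h}

variable {C} {G : Set C.LocalRing} {H : Set (Fin r → K⟦X⟧)}

theorem isKReduction_iff {k : Fin r} {w w' : Fin r → K⟦X⟧} :
    C.IsKReduction G H k w w' ↔ KReduces (C.prods G H) k w w' := by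
  constructor
  · rintro ⟨h1, ⟨c, m, hm, h, hh, rfl⟩, h2⟩
    exact ⟨h1, ⟨c, _, ⟨m, hm, h, hh, rfl⟩, rfl⟩, h2⟩
  · rintro ⟨h1, ⟨c, _, ⟨m, hm, h, hh, rfl⟩, rfl⟩, h2⟩
    exact ⟨h1, ⟨c, m, hm, h, hh, rfl⟩, h2⟩

theorem isReduction_iff {w w' : Fin r → K⟦X⟧} :
    C.IsReduction G H w w' ↔ ∃ k, KReduces (C.prods G H) k w w' :=
  exists_congr fun _ => isKReduction_iff

theorem isFinalReduction_iff {w w' : Fin r → K⟦X⟧} : C.IsFinalReduction G H w w' ↔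
    ReducesTo (C.prods G H) w w' ∧ ∀ k w'', ¬ KReduces (C.prods G H) k w' w'' := by
  unfold IsFinalReduction ReducesTo
  simp only [isReduction_iff, not_exists]
  exact and_congr_right fun _ => forall_comm

theorem exists_mem_pow {m : C.LocalRing} (hm : m ∈ Submonoid.closure G) : ∃ n : ℕ, m ∈ G ^ n := by
  induction hm using Submonoid.closure_induction with
  | mem x hx => exact ⟨1, by rwa [pow_one]⟩
  | one => exact ⟨0, by simp⟩
  | mul x y _ _ hx hy =>
    obtain ⟨a, ha⟩ := hx
    obtain ⟨b, hb⟩ := hy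
    exact ⟨a + b, by rw [pow_add]; exact Set.mul_mem_mul ha hb⟩

theorem le_order_psi_of_mem_pow (hG : G ⊆ nonunits C.LocalRing) {n : ℕ} {m : C.LocalRing}
    (hm : m ∈ G ^ n) (i : Fin r) : (n : ℕ∞) ≤ (C.psi m i).order := by
  induction n generalizing m with
  | zero => simp
  | succ n ih =>
    rw [pow_succ] at hm
    obtain ⟨a, ha, g, hg, rfl⟩ := Set.mem_mul.mp hm
    rw [map_mul, Pi.mul_apply, PowerSeries.order_mul, Nat.cast_add, Nat.cast_one]
    exact add_le_add (ih ha) (C.one_le_order_psi (hG hg) i)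

theorem finite_pow {M : Type*} [Monoid M] {s : Set M} (hs : s.Finite) (n : ℕ) : (s ^ n).Finite := by
  induction n with
  | zero => simp
  | succ n ih => rw [pow_succ]; exact ih.mul hs

/-- A bound on one value bounds the number of factors from the finite set G, each of which
contributes at least 1. -/
theorem finiteBelow_prods (hGfin : G.Finite) (hG : G ⊆ nonunits C.LocalRing) (hH : H.Finite) :
    FiniteBelow (C.prods G H) := by
  intro B
  have hfin : (⋃ n ∈ Set.Iic B, G ^ n).Finite :=
    (Set.finite_Iic B).biUnion fun n _ => finite_pow hGfin n
  refine (Set.Finite.image2 (fun m h => C.psi m * h) hfin hH).subset ?_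
  rintro _ ⟨⟨m, hm, h, hh, rfl⟩, i, hi⟩
  obtain ⟨n, hn⟩ := exists_mem_pow hm
  refine ⟨m, Set.mem_biUnion (x := n) ?_ hn, h, hh, rfl⟩
  rw [Pi.mul_apply, PowerSeries.order_mul] at hi
  have := (le_order_psi_of_mem_pow hG hn i).trans (le_self_add.trans hi)
  exact_mod_cast this

theorem prods_subset_differentials (hH : H ⊆ C.differentials) : C.prods G H ⊆ C.differentials := by
  rintro _ ⟨m, -, h, hh, rfl⟩
  exact C.psi_mul_mem_differentials m (hH hh)

theorem subset_prods : H ⊆ C.prods G H := fun h hh =>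
  ⟨1, one_mem _, h, hh, by rw [map_one, one_mul]⟩

/-! ### Reductions of elements with a large value -/

/-- The tuple that is t^n on branch k and 0 elsewhere lies in O; any reduction of it must use such a
G-product. -/
theorem exists_closure_order_eq (hG : C.IsStandardBasisLocalRing G) {k : Fin r} {n : ℕ}
    (hn : C.conductorExponent k ≤ n) :
    ∃ m ∈ Submonoid.closure G, (C.psi m k).order = n ∧ ∀ i, i ≠ k → C.psi m i = 0 := by
  have hmem : Pi.single k (PowerSeries.X ^ n) ∈ Set.range C.psi := by
    refine C.mem_range_psi_of_le_order fun i => ?_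
    by_cases hi : i = k
    · subst hi
      rw [Pi.single_eq_same, PowerSeries.order_X_pow]
      exact_mod_cast hn
    · rw [Pi.single_eq_of_ne hi, PowerSeries.order_zero]
      exact le_top
  have hne : (Pi.single k (PowerSeries.X ^ n) : Fin r → K⟦X⟧) ≠ 0 := by
    rw [Ne, Pi.single_eq_zero_iff]
    exact pow_ne_zero _ PowerSeries.X_ne_zero
  obtain ⟨w', hw'⟩ := hG.2.2.2.2 _ hmem hne
  obtain ⟨j, hj⟩ := isReduction_iff.mp hw'
  obtain ⟨c, _, ⟨m, hm, h, hh, rfl⟩, -, hle, heq⟩ := hj.exists_eq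
  rw [Set.mem_singleton_iff.mp hh, mul_one] at hle heq
  have hjk : j = k := by
    by_contra hjk
    exact hj.1 (by rw [Pi.single_eq_of_ne hjk, PowerSeries.order_zero])
  subst hjk
  rw [Pi.single_eq_same, PowerSeries.order_X_pow] at heq
  refine ⟨m, hm, heq, fun i hi => ?_⟩
  have := hle i
  rwa [Pi.single_eq_of_ne hi, PowerSeries.order_zero, top_le_iff, PowerSeries.order_eq_top] at this

/-- An element with a finite value not below the conductor has a reduction. -/
theorem exists_kReduces_of_le_order [CharZero K] (hG : C.IsStandardBasisLocalRing G)
    (hH : C.initial G ⊆ H) {w : Fin r → K⟦X⟧} {k : Fin r} (h1 : 1 ≤ (w k).order)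
    (hσ : (C.conductorExponent k : ℕ∞) ≤ (w k).order) (ht : (w k).order ≠ ⊤) :
    ∃ w', KReduces (C.prods G H) k w w' := by
  obtain ⟨n, hn⟩ := ENat.ne_top_iff_exists.mp ht
  rw [← hn] at h1 hσ
  obtain ⟨m, hm, hmk, hmi⟩ := exists_closure_order_eq hG (by exact_mod_cast hσ : _ ≤ n)
  -- A positive value guarantees a factor g; replacing it by dg preserves all values in
  -- characteristic zero.
  obtain ⟨g, hg, m', hm', rfl⟩ : ∃ g ∈ G, ∃ m' ∈ Submonoid.closure G, m = g * m' := by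
    induction hm using Submonoid.closure_induction_left with
    | one =>
      rw [map_one, Pi.one_apply, PowerSeries.order_one] at hmk
      rw [← hmk] at h1
      simp at h1
    | mul_left g hg m' hm' _ => exact ⟨g, hg, m', hm', rfl⟩
  have hord : ∀ i, ((C.psi m' * euler (C.psi g)) i).order = (C.psi (g * m') i).order := by
    intro i
    rw [map_mul, Pi.mul_apply, Pi.mul_apply, PowerSeries.order_mul, PowerSeries.order_mul,
      order_euler (C.one_le_order_psi (hG.2.1 hg).1 i), add_comm]
  refine KReduces.exists_of_order (p := C.psi m' * euler (C.psi g))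
    ⟨m', hm', _, hH ⟨g, hg, C.pullback_d g⟩, rfl⟩ ht (fun i => ?_) ?_
  · rw [hord]
    by_cases hi : i = k
    · subst hi
      rw [hmk, hn]
    · rw [hmi i hi, PowerSeries.order_zero]
      exact le_top
  · rw [hord, hmk, hn]

theorem reducesTo_mem_differentials [CharZero K] (hH : H ⊆ C.differentials) {w w' : Fin r → K⟦X⟧}
    (h : ReducesTo (C.prods G H) w w') (hw : w ∈ C.differentials) : w' ∈ C.differentials := by
  refine C.mem_differentials_of_limit fun N => ?_
  obtain ⟨u, hu, hmem⟩ := h.exists_mem_spanAbove N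
  refine ⟨-u, fun i => ?_, ?_⟩
  · rw [Pi.neg_apply, PowerSeries.order_neg]
    exact hu i
  · have hle : spanAbove (C.prods G H) (fun i => (w i).order) ≤ C.differentials :=
      Submodule.span_le.mpr fun p hp => prods_subset_differentials hH hp.1
    have := sub_mem hw (hle hmem)
    have he : w - (w - w' - u) = w' - -u := by abel
    rwa [he] at this

/-- A nonzero final reduction would still have a finite value not below the conductor, and so a
further reduction. -/
theorem reducesTo_zero_of_le_order [CharZero K] (hG : C.IsStandardBasisLocalRing G)
    (hHfin : H.Finite) (hH : H ⊆ C.differentials) (hH₀ : C.initial G ⊆ H) {w : Fin r → K⟦X⟧}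
    (hw : w ∈ C.differentials) (hσ : ∀ i, (C.conductorExponent i : ℕ∞) ≤ (w i).order) :
    ReducesTo (C.prods G H) w 0 := by
  obtain ⟨w', hred, hirr⟩ := exists_final_reduction
    (finiteBelow_prods hG.1 (fun g hg => (hG.2.1 hg).1) hHfin) w
  have h0 : w' = 0 := by
    by_contra hne
    obtain ⟨k, hk⟩ := Function.ne_iff.mp hne
    obtain ⟨w'', hw''⟩ := exists_kReduces_of_le_order hG hH₀
      (C.one_le_order_of_mem_differentials (reducesTo_mem_differentials hH hred hw) k)
      ((hσ k).trans (hred.order_le k)) (PowerSeries.order_eq_top.not.mpr hk)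
    exact hirr k w'' hw''
  rwa [← h0]

/-! ### Representations of differentials -/

/-- A final reduction of an element of O stays in O, because O is closed, and is therefore 0 by the
Standard Basis property. -/
theorem psi_mem_spanAbove_sup_tail (hG : C.IsStandardBasisLocalRing G) (g : C.LocalRing) (N : ℕ) :
    C.psi g ∈ spanAbove (C.prods G {1}) 0 ⊔ tail N := by
  obtain ⟨w', hred, hirr⟩ := exists_final_reduction
    (finiteBelow_prods hG.1 (fun g hg => (hG.2.1 hg).1) (Set.finite_singleton 1)) (C.psi g)
  have hmem : w' ∈ Set.range C.psi := by
    refine C.mem_range_psi_of_limit fun N => ?_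
    obtain ⟨u, hu, hspan⟩ := hred.exists_mem_spanAbove N
    refine ⟨-u, fun i => ?_, ?_⟩
    · rw [Pi.neg_apply, PowerSeries.order_neg]
      exact hu i
    · have hsub : ∀ x ∈ spanAbove (C.prods G {1}) (fun i => (C.psi g i).order),
          x ∈ Set.range C.psi := by
        intro x hx
        induction hx using Submodule.span_induction with
        | mem p hp =>
          obtain ⟨m, -, h, hh, rfl⟩ := hp.1
          exact ⟨m, by rw [Set.mem_singleton_iff.mp hh, mul_one]⟩
        | zero => exact ⟨0, map_zero _⟩
        | add x y _ _ hx hy =>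
          obtain ⟨a, rfl⟩ := hx
          obtain ⟨b, rfl⟩ := hy
          exact ⟨a + b, map_add _ _ _⟩
        | smul c x _ hx =>
          obtain ⟨a, rfl⟩ := hx
          exact ⟨C.cls (algebraMap K _ c) * a, by rw [map_mul, C.smul_eq_psi_mul]⟩
      obtain ⟨a, ha⟩ := hsub _ hspan
      refine ⟨g - a, ?_⟩
      rw [map_sub, ha]
      abel
  have h0 : w' = 0 := by
    by_contra hne
    obtain ⟨w'', hw''⟩ := hG.2.2.2.2 w' hmem hne
    obtain ⟨k, hk⟩ := isReduction_iff.mp hw''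
    exact hirr k w'' hk
  rw [h0] at hred
  exact spanAbove_sup_tail_mono (fun i => zero_le) (hred.mem_spanAbove_sup_tail N)

theorem mul_mem_spanAbove {a b : Fin r → K⟦X⟧} (ha : a ∈ spanAbove (C.prods G {1}) 0)
    (hb : b ∈ spanAbove (C.prods G H) 0) : a * b ∈ spanAbove (C.prods G H) 0 := by
  induction ha using Submodule.span_induction with
  | mem p hp =>
    obtain ⟨m, hm, _, hh, rfl⟩ := hp.1
    rw [Set.mem_singleton_iff.mp hh, mul_one]
    induction hb using Submodule.span_induction with
    | mem q hq =>
      obtain ⟨m', hm', h, hh, rfl⟩ := hq.1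
      refine Submodule.subset_span ⟨⟨m * m', mul_mem hm hm', h, hh, ?_⟩, fun i => zero_le⟩
      rw [map_mul, mul_assoc]
    | zero => simp
    | add x y _ _ hx hy =>
      rw [mul_add]
      exact add_mem hx hy
    | smul c x _ hx =>
      rw [mul_smul_comm]
      exact Submodule.smul_mem _ c hx
  | zero => simp
  | add x y _ _ hx hy =>
    rw [add_mul]
    exact add_mem hx hy
  | smul c x _ hx =>
    rw [smul_mul_assoc]
    exact Submodule.smul_mem _ c hx

/-- The Leibniz rule turns the differential of a G-product into a sum of terms m·dg. -/
theorem euler_mem_spanAbove (hH : C.initial G ⊆ H) {a : Fin r → K⟦X⟧}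
    (ha : a ∈ spanAbove (C.prods G {1}) 0) : euler a ∈ spanAbove (C.prods G H) 0 := by
  have hpsi : ∀ m ∈ Submonoid.closure G, C.psi m ∈ spanAbove (C.prods G {1}) 0 := fun m hm =>
    Submodule.subset_span ⟨⟨m, hm, 1, rfl, (mul_one _).symm⟩, fun i => zero_le⟩
  induction ha using Submodule.span_induction with
  | mem p hp =>
    obtain ⟨m, hm, _, hh, rfl⟩ := hp.1
    rw [Set.mem_singleton_iff.mp hh, mul_one]
    clear hp hh
    induction hm using Submonoid.closure_induction with
    | mem g hg =>
      refine Submodule.subset_span ⟨subset_prods (hH ⟨g, hg, ?_⟩), fun i => zero_le⟩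
      exact C.pullback_d g
    | one => rw [map_one, euler_one]; exact zero_mem _
    | mul x y hx hy hx' hy' =>
      rw [map_mul, euler_mul]
      exact add_mem (mul_mem_spanAbove (hpsi x hx) hy') (mul_mem_spanAbove (hpsi y hy) hx')
  | zero => rw [map_zero]; exact zero_mem _
  | add x y _ _ hx hy =>
    rw [map_add]
    exact add_mem hx hy
  | smul c x _ hx =>
    rw [map_smul]
    exact Submodule.smul_mem _ c hx

theorem psi_mul_euler_mem_spanAbove_sup_tail (hG : C.IsStandardBasisLocalRing G)
    (hH : C.initial G ⊆ H) (p x : C.LocalRing) (N : ℕ) :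
    C.psi p * euler (C.psi x) ∈ spanAbove (C.prods G H) 0 ⊔ tail N := by
  obtain ⟨a, ha, u, hu, hp⟩ := Submodule.mem_sup.mp (psi_mem_spanAbove_sup_tail hG p N)
  obtain ⟨b, hb, v, hv, hx⟩ := Submodule.mem_sup.mp (psi_mem_spanAbove_sup_tail hG x N)
  rw [← hp, ← hx, map_add]
  refine Submodule.mem_sup.mpr ⟨a * euler b, mul_mem_spanAbove ha (euler_mem_spanAbove hH hb),
    (a + u) * euler v + euler b * u, add_mem (mul_mem_tail _ fun i => le_order_euler (hv i))
      (mul_mem_tail _ hu), ?_⟩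
  ring

theorem differentials_le_spanAbove_sup_tail (hG : C.IsStandardBasisLocalRing G)
    (hH : C.initial G ⊆ H) {w : Fin r → K⟦X⟧} (hw : w ∈ C.differentials) (N : ℕ) :
    w ∈ spanAbove (C.prods G H) 0 ⊔ tail N := by
  obtain ⟨ω, rfl⟩ := hw
  obtain ⟨p, q, h⟩ := C.exists_pullback_eq ω
  rw [h]
  exact add_mem (psi_mul_euler_mem_spanAbove_sup_tail hG hH p _ N)
    (psi_mul_euler_mem_spanAbove_sup_tail hG hH q _ N)

/-! ### Finiteness of the set of processes -/

theorem IsRepresentatives.finite {S T F : Set (Fin r → K⟦X⟧)} (hT : IsRepresentatives S T)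
    (hF : F.Finite) (hcover : ∀ w ∈ S, ∃ s ∈ F, ∃ c : K, c ≠ 0 ∧ w = c • s) : T.Finite := by
  choose! g hg c hc hw using hcover
  refine Set.Finite.of_injOn (f := g) (t := F) (fun w h => hg w (hT.1 h)) (fun a ha b hb hab => ?_) hF
  have hab' : a = (c a * (c b)⁻¹) • b := by
    have hgb : g b = (c b)⁻¹ • b := (eq_inv_smul_iff₀ (hc b (hT.1 hb))).mpr (hw b (hT.1 hb)).symm
    rw [mul_smul, ← hgb, ← hab]
    exact hw a (hT.1 ha)
  exact (hT.2 a (hT.1 ha)).unique ⟨ha, 1, one_ne_zero, (one_smul _ _).symm⟩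
    ⟨hb, _, mul_ne_zero (hc a (hT.1 ha)) (inv_ne_zero (hc b (hT.1 hb))), hab'⟩

theorem exists_isRepresentatives (S : Set (Fin r → K⟦X⟧)) : ∃ T, IsRepresentatives S T := by
  let R : Setoid (Fin r → K⟦X⟧) :=
    { r := fun w w' => ∃ c : K, c ≠ 0 ∧ w = c • w'
      iseqv :=
        { refl := fun w => ⟨1, one_ne_zero, (one_smul _ _).symm⟩
          symm := by
            rintro w w' ⟨c, hc, rfl⟩
            exact ⟨c⁻¹, inv_ne_zero hc, (inv_smul_smul₀ hc _).symm⟩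
          trans := by
            rintro w w' w'' ⟨c, hc, rfl⟩ ⟨d, hd, rfl⟩
            exact ⟨c * d, mul_ne_zero hc hd, smul_smul _ _ _⟩ } }
  obtain ⟨T, hTS, hT⟩ := Set.exists_subset_bijOn S (Quotient.mk R)
  refine ⟨T, hTS, fun w hw => ?_⟩
  obtain ⟨w₀, hw₀, he⟩ := hT.surjOn ⟨w, hw, rfl⟩
  exact ⟨w₀, ⟨hw₀, Quotient.exact he.symm⟩, fun v hv =>
    hT.injOn hv.1 hw₀ ((Quotient.sound (s := R) hv.2).symm.trans he.symm)⟩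

theorem exists_finite_cover_processes (hP : FiniteBelow (C.prods G H)) (σ : Fin r → ℕ) :
    ∃ F : Set (Fin r → K⟦X⟧), F.Finite ∧
      ∀ w ∈ C.processes G σ H, ∃ s ∈ F, ∃ c : K, c ≠ 0 ∧ w = c • s := by
  set B := Finset.univ.sup σ with hBdef
  obtain ⟨B', hB'⟩ := hP.exists_bound B
  set P₁ := {p ∈ C.prods G H | ∃ i, (p i).order ≤ ((B + B' : ℕ) : ℕ∞)} with hP₁
  have hB : ∀ {p : Fin r → K⟦X⟧} {i : Fin r}, (p i).order < (σ i : ℕ∞) → (p i).order ≤ (B : ℕ∞) :=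
    fun {p i} h => h.le.trans (by exact_mod_cast Finset.le_sup (Finset.mem_univ i))
  have hsmall : ∀ p ∈ C.prods G H, ∀ i, (p i).order < (σ i : ℕ∞) → p ∈ P₁ := fun p hp i hi =>
    ⟨hp, i, (hB hi).trans (by exact_mod_cast Nat.le_add_right B B')⟩
  have hpair : ∀ p ∈ C.prods G H, ∀ q ∈ C.prods G H, ∀ i k, (p i).order < (σ i : ℕ∞) →
      (p k).order = (q k).order → (p k).order ≠ ⊤ → q ∈ P₁ := fun p hp q hq i k hi hk ht =>
    ⟨hq, k, by
      rw [← hk]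
      exact (hB' p hp ⟨i, hB hi⟩ k ht).le.trans (by exact_mod_cast Nat.le_add_left B' B)⟩
  have hP₁fin : P₁.Finite := hP (B + B')
  refine ⟨P₁ ∪ (fun x : ((Fin r → K⟦X⟧) × (Fin r → K⟦X⟧)) × Fin r => x.1.1 -
      (PowerSeries.coeff (x.1.1 x.2).order.toNat (x.1.1 x.2) /
        PowerSeries.coeff (x.1.1 x.2).order.toNat (x.1.2 x.2)) • x.1.2) '' ((P₁ ×ˢ P₁) ×ˢ Set.univ),
    hP₁fin.union (((hP₁fin.prod hP₁fin).prod Set.finite_univ).image _), ?_⟩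
  rintro w ⟨⟨k, c₁, c₂, m₁, hm₁, m₂, hm₂, h₁, hh₁, h₂, hh₂, hw, hlt⟩, i, hi⟩
  have hp : C.psi m₁ * h₁ ∈ C.prods G H := ⟨m₁, hm₁, h₁, hh₁, rfl⟩
  have hq : C.psi m₂ * h₂ ∈ C.prods G H := ⟨m₂, hm₂, h₂, hh₂, rfl⟩
  generalize C.psi m₁ * h₁ = p at *
  generalize C.psi m₂ * h₂ = q at *
  have hw0 : ∀ v : Fin r → K⟦X⟧, w ≠ (0 : K) • v := by
    rintro v rfl
    simp at hi
  -- The definition admits a zero coefficient; the process is then a multiple of a single product.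
  by_cases hc₁ : c₁ = 0
  · rw [hc₁, zero_smul, zero_add] at hw
    have hc₂ : c₂ ≠ 0 := by
      rintro rfl
      exact hw0 q hw
    refine ⟨q, Or.inl (hsmall q hq i ?_), c₂, hc₂, hw⟩
    rwa [hw, Pi.smul_apply, order_smul_of_ne_zero hc₂] at hi
  by_cases hc₂ : c₂ = 0
  · rw [hc₂, zero_smul, add_zero] at hw
    refine ⟨p, Or.inl (hsmall p hp i ?_), c₁, hc₁, hw⟩
    rwa [hw, Pi.smul_apply, order_smul_of_ne_zero hc₁] at hi
  have heq : (p k).order = (q k).order := by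
    by_contra hne
    have h := PowerSeries.order_add_of_order_ne (c₁ • p k) (c₂ • q k)
      (by rwa [order_smul_of_ne_zero hc₁, order_smul_of_ne_zero hc₂])
    rw [order_smul_of_ne_zero hc₁, order_smul_of_ne_zero hc₂] at h
    rw [hw] at hlt
    exact absurd h hlt.ne'
  rw [heq, min_self] at hlt
  have ht : (q k).order ≠ ⊤ := hlt.ne_top
  -- One of the two products has a value below the conductor, which bounds its finite k-th value;
  -- the other shares that k-th value.
  have hmem : p ∈ P₁ ∧ q ∈ P₁ := by
    have hmin := PowerSeries.min_order_le_order_add (c₁ • p i) (c₂ • q i)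
    rw [order_smul_of_ne_zero hc₁, order_smul_of_ne_zero hc₂] at hmin
    have hwi : w i = c₁ • p i + c₂ • q i := by rw [hw]; rfl
    rw [← hwi] at hmin
    rcases min_lt_iff.mp (hmin.trans_lt hi) with h | h
    · exact ⟨hsmall p hp i h, hpair p hp q hq i k h heq (by rwa [heq])⟩
    · exact ⟨hpair q hq p hp i k h heq.symm ht, hsmall q hq i h⟩
  refine ⟨_, Or.inr ⟨((p, q), k), ⟨⟨hmem.1, hmem.2⟩, Set.mem_univ _⟩, rfl⟩, c₁, hc₁, ?_⟩
  simp only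
  obtain ⟨n, hn⟩ := ENat.ne_top_iff_exists.mp ht
  rw [heq, ← hn, ENat.toNat_natCast]
  have hqn : PowerSeries.coeff n (q k) ≠ 0 := (PowerSeries.order_eq_nat.mp hn.symm).1
  have hcoeff : c₁ * PowerSeries.coeff n (p k) + c₂ * PowerSeries.coeff n (q k) = 0 := by
    have h := PowerSeries.coeff_of_lt_order n (hn ▸ hlt)
    rw [hw] at h
    simpa using h
  rw [hw, smul_sub, smul_smul, sub_eq_add_neg, ← neg_smul]
  congr 2
  field_simp
  linear_combination hcoeff

/-! ### The loop -/

theorem Step.exists_irreducible {σ : Fin r → ℕ} {H' : Set (Fin r → K⟦X⟧)} (h : C.Step G σ H H')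
    (hne : H' ≠ H) : ∃ w ∈ H', w ≠ 0 ∧ ∀ k w', ¬ KReduces (C.prods G H) k w w' := by
  obtain ⟨T, ρ, hT, hρ, rfl⟩ := h
  obtain ⟨w, hw⟩ : ∃ w, w ∈ ρ '' T \ {0} := by
    by_contra! hempty
    exact hne (by rw [Set.eq_empty_of_forall_notMem hempty, Set.union_empty])
  obtain ⟨⟨t, ht, rfl⟩, h0⟩ := id hw
  exact ⟨ρ t, Or.inr hw, h0, (isFinalReduction_iff.mp (hρ t ht)).2⟩

theorem Step.subset {σ : Fin r → ℕ} {H' : Set (Fin r → K⟦X⟧)} (h : C.Step G σ H H') : H ⊆ H' := by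
  obtain ⟨T, ρ, -, -, rfl⟩ := h
  exact Set.subset_union_left

/-- Already v itself reduces w, so an irreducible element has a value vector not occurring in H. -/
theorem exists_kReduces_of_mem {w : Fin r → K⟦X⟧} (hw0 : w ≠ 0) {v : Fin r → K⟦X⟧} (hv : v ∈ H)
    (he : ∀ i, (v i).order = (w i).order) : ∃ k w', KReduces (C.prods G H) k w w' := by
  obtain ⟨k, hk⟩ := Function.ne_iff.mp hw0
  exact ⟨k, KReduces.exists_of_order (subset_prods hv) (PowerSeries.order_eq_top.not.mpr hk)
    (fun i => (he i).ge) (he k)⟩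

theorem Step.finite {σ : Fin r → ℕ} {H' : Set (Fin r → K⟦X⟧)} (h : C.Step G σ H H')
    (hP : FiniteBelow (C.prods G H)) (hHfin : H.Finite) : H'.Finite := by
  obtain ⟨T, ρ, hT, -, rfl⟩ := h
  obtain ⟨F, hF, hcover⟩ := exists_finite_cover_processes hP σ
  exact hHfin.union (((hT.finite hF hcover).image ρ).subset Set.sdiff_subset)

theorem processes_subset_differentials (hH : H ⊆ C.differentials) {σ : Fin r → ℕ} :
    C.processes G σ H ⊆ C.differentials := by
  rintro w ⟨⟨k, c₁, c₂, m₁, hm₁, m₂, hm₂, h₁, hh₁, h₂, hh₂, rfl, -⟩, -⟩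
  exact add_mem (Submodule.smul_mem _ _ (C.psi_mul_mem_differentials m₁ (hH hh₁)))
    (Submodule.smul_mem _ _ (C.psi_mul_mem_differentials m₂ (hH hh₂)))

theorem initial_subset [CharZero K] (hG : C.IsStandardBasisLocalRing G) :
    C.initial G ⊆ (C.differentials : Set (Fin r → K⟦X⟧)) \ {0} := by
  rintro _ ⟨g, hg, rfl⟩
  refine ⟨⟨C.d g, rfl⟩, fun h0 => (hG.2.1 hg).2 (C.psi_injective ?_)⟩
  rw [map_zero]
  funext i
  rw [Pi.zero_apply, ← PowerSeries.order_eq_top, ← order_euler (C.one_le_order_psi (hG.2.1 hg).1 i),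
    ← C.pullback_d]
  have h0' : C.pullback (C.d g) = 0 := h0
  rw [h0', Pi.zero_apply, PowerSeries.order_zero]

theorem Reachable.invariant [CharZero K] (hG : C.IsStandardBasisLocalRing G) {σ : Fin r → ℕ}
    (h : C.Reachable G σ H) :
    H.Finite ∧ H ⊆ (C.differentials : Set (Fin r → K⟦X⟧)) \ {0} ∧ C.initial G ⊆ H := by
  induction h with
  | refl => exact ⟨hG.1.image _, initial_subset hG, subset_rfl⟩
  | tail _ hstep ih =>
    obtain ⟨hfin, hsub, hinit⟩ := ih
    have hdiff := hsub.trans Set.sdiff_subset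
    refine ⟨hstep.finite (finiteBelow_prods hG.1 (fun g hg => (hG.2.1 hg).1) hfin)
      hfin, ?_, hinit.trans hstep.subset⟩
    obtain ⟨T, ρ, hT, hρ, rfl⟩ := hstep
    refine Set.union_subset hsub (Set.sdiff_subset_sdiff_left ?_)
    rintro _ ⟨t, ht, rfl⟩
    exact reducesTo_mem_differentials hdiff (isFinalReduction_iff.mp (hρ t ht)).1
      (processes_subset_differentials hdiff (hT.1 ht))

theorem exists_step (hG : C.IsStandardBasisLocalRing G) (hHfin : H.Finite)
    (σ : Fin r → ℕ) :
    (∃ T, T.Finite ∧ IsRepresentatives (C.processes G σ H) T) ∧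
      (∀ w, ∃ w', C.IsFinalReduction G H w w') ∧ ∃ H', C.Step G σ H H' := by
  have hP := finiteBelow_prods hG.1 (fun g hg => (hG.2.1 hg).1) hHfin
  obtain ⟨T, hT⟩ := exists_isRepresentatives (C.processes G σ H)
  obtain ⟨F, hF, hcover⟩ := exists_finite_cover_processes hP σ
  have hfinal : ∀ w, ∃ w', C.IsFinalReduction G H w w' := fun w =>
    (exists_final_reduction hP w).imp fun _ h => isFinalReduction_iff.mpr h
  choose ρ hρ using hfinal
  exact ⟨⟨T, hT.finite hF hcover, hT⟩, fun w => ⟨ρ w, hρ w⟩, _, T, ρ, hT, fun w _ => hρ w, rfl⟩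

theorem exists_step_eq [CharZero K] (hG : C.IsStandardBasisLocalRing G) {σ : Fin r → ℕ}
    (H : ℕ → Set (Fin r → K⟦X⟧)) (h0 : H 0 = C.initial G)
    (hstep : ∀ j, C.Step G σ (H j) (H (j + 1))) : ∃ j, H (j + 1) = H j := by
  by_contra! hne
  have hreach : ∀ j, C.Reachable G σ (H j) := by
    intro j
    induction j with
    | zero => rw [h0]; exact Relation.ReflTransGen.refl
    | succ j ih => exact ih.tail (hstep j)
  have hmono : Monotone H := monotone_nat_of_le_succ fun j => (hstep j).subset
  choose w hw hw0 hirr using fun j => (hstep j).exists_irreducible (hne j)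
  have hinj : Function.Injective fun j i => (w j i).order := by
    refine Function.Injective.of_lt_imp_ne fun a b hab he => ?_
    obtain ⟨k, w', h⟩ := exists_kReduces_of_mem (G := G) (H := H b) (hw0 b)
      (hmono (Nat.succ_le_of_lt hab) (hw a)) (fun i => congrFun he i)
    exact hirr b k w' h
  -- A finite value beyond the exponent plus 1 is positive and not below the conductor,
  -- contradicting irreducibility.
  have hrange : (Set.range fun j i => (w j i).order) ⊆ Set.univ.pi fun i =>
      insert ⊤ ((fun n : ℕ => (n : ℕ∞)) '' Set.Iic (C.conductorExponent i + 1)) := by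
    rintro _ ⟨j, rfl⟩ i -
    by_cases ht : (w j i).order = ⊤
    · exact Or.inl ht
    obtain ⟨n, hn⟩ := ENat.ne_top_iff_exists.mp ht
    refine Or.inr ⟨n, ?_, hn⟩
    by_contra hlarge
    rw [Set.mem_Iic, not_le] at hlarge
    obtain ⟨w', h⟩ := exists_kReduces_of_le_order (H := H j) hG ((hreach j).invariant hG).2.2
      (w := w j) (k := i) (by rw [← hn]; exact_mod_cast (by omega : 1 ≤ n))
      (by rw [← hn]; exact_mod_cast (by omega : C.conductorExponent i ≤ n)) ht
    exact hirr j i w' h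
  exact (Set.infinite_range_of_injective hinj)
    ((Set.Finite.pi' fun i => ((Set.finite_Iic _).image _).insert ⊤).subset
      (hrange.trans fun f hf i => hf i (Set.mem_univ i)))

theorem isStandardBasisOmega_of_step_self [CharZero K] (hG : C.IsStandardBasisLocalRing G)
    (hreach : C.Reachable G C.conductorExponent H) (hstep : C.Step G C.conductorExponent H H) :
    C.IsStandardBasisOmega G H := by
  obtain ⟨hfin, hsub, hinit⟩ := hreach.invariant hG
  have hdiff := hsub.trans Set.sdiff_subset
  have hP := finiteBelow_prods hG.1 (fun g hg => (hG.2.1 hg).1) hfin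
  refine ⟨hG.1, hG.2.1, hfin, hsub, fun w hw hw0 => ?_⟩
  have hproc : ∀ w ∈ C.processes G C.conductorExponent H, ∀ N,
      w ∈ spanAbove (C.prods G H) (fun i => (w i).order) ⊔ tail N := by
    obtain ⟨T, ρ, hT, hρ, hH⟩ := hstep
    intro w hw N
    obtain ⟨w₀, ⟨hw₀, c, hc, rfl⟩, -⟩ := hT.2 w hw
    have hred := isFinalReduction_iff.mp (hρ w₀ hw₀)
    -- A nonzero final reduction would belong to H, and so reduce itself.
    have h0 : ρ w₀ = 0 := by
      by_contra hne
      have hmem : ρ w₀ ∈ H := by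
        rw [hH]
        exact Or.inr ⟨⟨w₀, hw₀, rfl⟩, hne⟩
      obtain ⟨k, w', h⟩ := exists_kReduces_of_mem (G := G) hne hmem fun i => rfl
      exact hred.2 k w' h
    rw [h0] at hred
    have he : (fun i => ((c • w₀) i).order) = fun i => (w₀ i).order :=
      funext fun i => order_smul_of_ne_zero hc (w₀ i)
    rw [he]
    exact Submodule.smul_mem _ c (hred.1.mem_spanAbove_sup_tail N)
  obtain ⟨k, w', h⟩ := exists_kReduces_of_mem_spanAbove hP (fun N k p hp q hq c heq ht hlt => by
    by_cases hi : ∃ i, ((p - c • q) i).order < (C.conductorExponent i : ℕ∞)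
    · refine hproc _ ⟨⟨k, ?_⟩, hi⟩ N
      obtain ⟨m₁, hm₁, h₁, hh₁, rfl⟩ := hp
      obtain ⟨m₂, hm₂, h₂, hh₂, rfl⟩ := hq
      refine ⟨1, -c, m₁, hm₁, m₂, hm₂, h₁, hh₁, h₂, hh₂, ?_, ?_⟩
      · rw [one_smul, neg_smul, sub_eq_add_neg]
      · rwa [← heq, min_self]
    -- Differences with no value below the conductor are skipped by the algorithm, but they reduce
    -- to zero anyway.
    · push Not at hi
      have hmem : p - c • q ∈ C.differentials :=
        sub_mem (prods_subset_differentials hdiff hp)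
          (Submodule.smul_mem _ c (prods_subset_differentials hdiff hq))
      exact (reducesTo_zero_of_le_order hG hfin hdiff hinit hmem hi).mem_spanAbove_sup_tail N)
    hw0 (differentials_le_spanAbove_sup_tail hG hinit hw)
  exact ⟨w', isReduction_iff.mpr ⟨k, h⟩⟩

end ParamPlaneCurve

end

theorem proposition4 {K : Type*} [Field K] [IsAlgClosed K] [CharZero K] {r : ℕ} (hr : 0 < r)
    (C : ParamPlaneCurve K r) (G : Set C.LocalRing) (hG : C.IsStandardBasisLocalRing G)
    (hfG : ∀ i, C.cls (C.f i) ≠ 0 → C.cls (C.f i) ∈ G) :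
    ∃ σ : Fin r → ℕ,
      -- the bound is the conductor of the curve
      C.IsConductor σ ∧
      (∀ i, (σ i : ℕ∞) =
        (C.branchConductor i : ℕ∞) + ∑ j ∈ Finset.univ.erase i, (C.param i (C.f j)).order) ∧
      -- every passage through the loop can be carried out, with finitely many final reductions
      (∀ H, C.Reachable G σ H →
        H.Finite ∧
        (∃ T, T.Finite ∧ ParamPlaneCurve.IsRepresentatives (C.processes G σ H) T) ∧
        (∀ w ∈ C.processes G σ H, ∃ w', C.IsFinalReduction G H w w') ∧
        ∃ H', C.Step G σ H H') ∧
      -- every execution stops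
      (∀ H : ℕ → Set (Fin r → PowerSeries K), H 0 = C.initial G →
        (∀ j, C.Step G σ (H j) (H (j + 1))) → ∃ j, H (j + 1) = H j) ∧
      -- and its output is a Standard Basis for the module of Kähler differentials
      (∀ H, C.Reachable G σ H → C.Step G σ H H → C.IsStandardBasisOmega G H) := by
  refine ⟨C.conductorExponent, C.isConductor_conductorExponent, C.conductorExponent_eq,
    fun H hH => ?_, fun H h0 hstep => ParamPlaneCurve.exists_step_eq hG H h0 hstep,
    fun H hH hstep => ParamPlaneCurve.isStandardBasisOmega_of_step_self hG hH hstep⟩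
  have hfin := (hH.invariant hG).1
  obtain ⟨hT, hfinal, hstep⟩ := ParamPlaneCurve.exists_step hG hfin C.conductorExponent
  exact ⟨hfin, hT, fun w _ => hfinal w, hstep⟩
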